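/- Let $(V,\omega)$ be a symplectic vector space of dimension $2n$ over a field $k$ of arbitrary characteristic: $\omega$ is bilinear, $\omega(v,v)=0$ for all $v$, and $\omega^\flat:V\to V^*$, $v\mapsto\omega(\cdot,v)$, is an isomorphism. For $M\in\operatorname{End}(V)$ let $M^{*\omega}=(\omega^\flat)^{-1}M^*\omega^\flat$ be its symplectic adjoint, where $M^*$ is the dual map, and let $\varphi_M$ be its characteristic polynomial. For $A\in\operatorname{End}(V)$ such that $\omega_A(v,w):=\omega(v,Aw)$ is alternating, let $\psi_A(t)\in k[t]$ be the Pfaffian of the matrix $\bigl(\omega(v_i,(A-tE)v_j)\bigr)_{i,j}$, where $(v_1,\dots,v_{2n})=(e_1,f_1,\dots,e_n,f_n)$ and $(e_1,\dots,e_n,f_1,\dots,f_n)$ is any symplectic basis of $V$, i.e. $\omega(e_i,e_j)=\omega(f_i,f_j)=0$ and $\omega(e_i,f_j)=\delta_{ij}$; it does not depend on the choice of the basis. The same notions are used over the field $k(s)$ of rational functions for the extension of $\omega$ to $V\otimes_k k(s)$, and $M$, $M^{*\omega}$ also denote the extended endomorphisms. The symplectic characteristic polynomial of $M$ is $$\Phi_M(s,t)=\psi_{(M-sE)(M^{*\omega}-sE)}(t).$$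 It is a polynomial in $k[s,t]$, namely the Pfaffian above computed over $k[s]$ in $V\otimes_k k[s]$. For every $M\in\operatorname{End}(V)$: 1. $\Phi_M(0,t)=\psi_{MM^{*\omega}}(t)$. 2. $\Phi_M(s,0)=\varphi_M(s)$. 3. $\Phi_M(s,(\sigma-s)(\tau-s))=\psi_{MM^{*\omega}}(\sigma\tau)+\dots+\psi_{M+M^{*\omega}}(\sigma+\tau)(-s)^n$. That is, for all $\sigma,\tau$ in a commutative $k$-algebra $R$ (for instance elements of $k$, or indeterminates), the left side is a polynomial in $s$ over $R$ of degree at most $n$, with constant coefficient $\psi_{MM^{*\omega}}(\sigma\tau)$ and coefficient of $s^n$ equal to $(-1)^n\psi_{M+M^{*\omega}}(\sigma+\tau)$. 4. If $\lambda,\mu\in k$ and $\Phi_M(s,(\lambda-s)(\mu-s))=0$ in $k[s]$, then $\lambda$ and $\mu$ are eigenvalues of $M$, $\lambda\mu$ is an eigenvalue of $MM^{*\omega}$, and $\lambda+\mu$ is an eigenvalue of $M+M^{*\omega}$. 5. $\Phi_{P^{-1}MP}(s,t)=\Phi_M(s,t)$ for every $P\in\operatorname{Sp}(V,\omega)$,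 and $\Phi_{M^{*\omega}}(s,t)=\Phi_M(s,t)$. 6. $\Phi_M(s,t)^2$ is the characteristic polynomial (in $t$) of the endomorphism $(M-sE)(M^{*\omega}-sE)$ of $V\otimes_k k(s)$. 7. $\Phi_M(s,t)$ has degree $n$ in $t$, and if $\Phi_M(s,t)=a_0(s)+\dots+a_{n-1}(s)t^{n-1}+a_n(s)t^n$, then $a_0(s)=\varphi_M(s)$, $a_n(s)=(-1)^n$ and, if $n\ge1$, $$2a_{n-1}(s)=(-1)^{n-1}\{\operatorname{tr}(MM^{*\omega})-2(\operatorname{tr}M)s+2ns^2\}.$$ 8. $\Phi_M(s,(M-sE)(M^{*\omega}-sE))=O$ as an endomorphism of $V\otimes_k k(s)$. -/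

import Mathlib

universe u v w

open scoped Polynomial TensorProduct

noncomputable section

namespace Symplectic

/-- The Pfaffian of a `2n × 2n` alternating matrix over a commutative ring. Rows and columns are
indexed by `Fin n × Fin 2` in lexicographic order, so that `(i, 0)` and `(i, 1)` are the indices
`2i` and `2i + 1`. It is the sum of `sign σ * ∏ i, A_{σ(2i), σ(2i+1)}` over the permutations `σ`
with `σ(2i) < σ(2i+1)` for all `i` and `σ(0) < σ(2) < σ(4) < ⋯`, that is, over the perfect
matchings of the index set. No division is used, so it is right in every characteristic. -/
def pfaffian {R : Type*} [CommRing R] {n : ℕ}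
    (A : Matrix (Fin n × Fin 2) (Fin n × Fin 2) R) : R :=
  ∑ σ : Equiv.Perm (Fin n × Fin 2) with
      (∀ i, toLex (σ (i, 0)) < toLex (σ (i, 1))) ∧
        (∀ i j, i < j → toLex (σ (i, 0)) < toLex (σ (j, 0))),
    ((Equiv.Perm.sign σ : ℤ) : R) * ∏ i, A (σ (i, 0)) (σ (i, 1))

section Ring

variable {R V : Type*} [CommRing R] [AddCommGroup V] [Module R V]

/-- A symplectic form: alternating, and `ω♭ : V → V*`, `v ↦ ω(·, v)`, is an isomorphism. -/
structure IsSymplectic (ω : LinearMap.BilinForm R V) : Prop where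
  alt : ∀ v, ω v v = 0
  bijective_flat : Function.Bijective (LinearMap.flip ω)

/-- The isomorphism `ω♭ : V → V*`, `v ↦ ω(·, v)`. -/
def flat (ω : LinearMap.BilinForm R V) (hω : IsSymplectic ω) : V ≃ₗ[R] Module.Dual R V :=
  LinearEquiv.ofBijective (LinearMap.flip ω) hω.bijective_flat

/-- The symplectic adjoint `M^{*ω} = (ω♭)⁻¹ M* ω♭`, where `M*` is the dual map of `M`. -/
def adj (ω : LinearMap.BilinForm R V) (hω : IsSymplectic ω) (M : Module.End R V) :
    Module.End R V :=
  (flat ω hω).symm.toLinearMap ∘ₗ M.dualMap ∘ₗ (flat ω hω).toLinearMap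

/-- The symplectic group `Sp(V, ω)`. -/
def Sp (ω : LinearMap.BilinForm R V) : Subgroup (V ≃ₗ[R] V) where
  carrier := {P | ∀ v w, ω (P v) (P w) = ω v w}
  mul_mem' := by
    intro P Q hP hQ v w
    rw [LinearEquiv.mul_apply, LinearEquiv.mul_apply, hP, hQ]
  one_mem' := fun _ _ => rfl
  inv_mem' := by
    intro P hP v w
    have h := hP (P⁻¹ v) (P⁻¹ w)
    rw [← LinearEquiv.mul_apply, ← LinearEquiv.mul_apply, mul_inv_cancel] at h
    exact h.symm

/-- A basis `(e₁, …, eₙ, f₁, …, fₙ)`, with `eᵢ = b (inl i)` and `fᵢ = b (inr i)`, is symplectic if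
`ω(eᵢ, eⱼ) = 0`, `ω(fᵢ, fⱼ) = 0` and `ω(eᵢ, fⱼ) = δᵢⱼ`. -/
def IsSymplecticBasis (ω : LinearMap.BilinForm R V) {n : ℕ}
    (b : Module.Basis (Fin n ⊕ Fin n) R V) : Prop :=
  ∀ i j, ω (b (.inl i)) (b (.inl j)) = 0 ∧ ω (b (.inr i)) (b (.inr j)) = 0 ∧
    ω (b (.inl i)) (b (.inr j)) = if i = j then 1 else 0

/-- The rearrangement `(e₁, f₁, …, eₙ, fₙ)` of `(e₁, …, eₙ, f₁, …, fₙ)`. -/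
def interleave {n : ℕ} (b : Fin n ⊕ Fin n → V) : Fin n × Fin 2 → V :=
  fun p => if p.2 = 0 then b (.inl p.1) else b (.inr p.1)

/-- The matrix `(ω_{A - tE}(vᵢ, vⱼ))` with entries in `R[t]`, where
`ω_{A - tE}(v, w) = ω(v, A w) - t ω(v, w)`. -/
def pencil (ω : LinearMap.BilinForm R V) (A : Module.End R V) {n : ℕ} (v : Fin n × Fin 2 → V) :
    Matrix (Fin n × Fin 2) (Fin n × Fin 2) R[X] :=
  Matrix.of fun p q =>
    Polynomial.C (ω (v p) (A (v q))) - Polynomial.X * Polynomial.C (ω (v p) (v q))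

open Classical in
/-- `ψ_A(t) = Pf_ω(ω_{A - tE})`, for `A` such that `ω_A` is alternating: the Pfaffian of the matrix
of `ω_{A - tE}` in a symplectic basis `(e₁, f₁, …, eₙ, fₙ)`. A symplectic basis exists for each
symplectic form over a field, and for each base change of such a form. The Pfaffian does not
depend on the basis, since symplectic matrices have determinant one. (The value is `0` if there is
no symplectic basis.) -/
def psi (ω : LinearMap.BilinForm R V) (A : Module.End R V) : R[X] :=
  if h : ∃ (n : ℕ) (b : Module.Basis (Fin n ⊕ Fin n) R V), IsSymplecticBasis ω b then
    pfaffian (pencil ω A (interleave h.choose_spec.choose))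
  else 0

end Ring

section Field

variable {K V : Type*} [Field K] [AddCommGroup V] [Module K V]

/-- The endomorphism `(M - sE)(M^{*ω} - sE)` of `V ⊗ R`, for an element `s` of a commutative
`K`-algebra `R`; here `M` and `M^{*ω}` stand for their extensions to `V ⊗ R`. -/
def shiftProd (ω : LinearMap.BilinForm K V) (hω : IsSymplectic ω) (M : Module.End K V)
    (R : Type*) [CommRing R] [Algebra K R] (s : R) : Module.End R (R ⊗[K] V) :=
  (LinearMap.baseChange R M - s • 1) * (LinearMap.baseChange R (adj ω hω M) - s • 1)

/-- The symplectic characteristic polynomial `Φ_M(s, t) = ψ_{(M - sE)(M^{*ω} - sE)}(t)`, as an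
element of `K[s][t]`: the inner variable is `s`, the outer variable is `t`. -/
def charpoly (ω : LinearMap.BilinForm K V) (hω : IsSymplectic ω) (M : Module.End K V) : K[X][X] :=
  psi (LinearMap.BilinForm.baseChange K[X] ω) (shiftProd ω hω M K[X] Polynomial.X)

end Field

end Symplectic

end

/-!
Everything reduces to the Pfaffian of alternating matrices over commutative rings. Four facts about
it carry the proof:

* `pfaffian_congr`: `Pf(Bᵀ A B) = det B * Pf A`. The sum defining the Pfaffian, extended from
  perfect matchings to all permutations, visibly transforms by `det B` under congruence
  (`fullPfaffian_congr`), and it is `2 ^ n * n!` times the Pfaffian (`fullPfaffian_eq`). The factor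
  can be cancelled because both sides are integral polynomials in the entries, so that the identity
  may be checked over a polynomial ring over `ℤ`.
* `pfaffian_sq`: `Pf(A) ^ 2 = det A`. It is again enough to treat a field, where a regular
  alternating matrix is congruent to the standard one (existence of symplectic bases).
* `exists_mul_eq_pfaffian`: some matrix multiplies `A` to the scalar matrix `Pf(A)`. This is the
  expansion of the Pfaffian along a row, combined with congruence by the matrices which replace
  row and column `i` by row and column `j`.
* The Pfaffian of a linear pencil `A - X B` has degree at most `n`, constant coefficient `Pf A` and
  coefficient `(-1) ^ n * Pf B` at `X ^ n`.

Congruence shows that `ψ` does not depend on the symplectic basis (`psi_eq_pfaffian`); the square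
formula says that `ψ_A ^ 2` is the characteristic polynomial of `A` (`psi_sq`), from which the
trace formula follows by comparing coefficients; the adjugate gives the Cayley-Hamilton theorem for
`ψ` (`aeval_self_psi`). Over `K[s]` or `K(s)` the Gram matrix of `(M - s)(M^{*ω} - s)` is the
explicit quadratic polynomial `P - s Q + s ^ 2 J`, with `P` and `Q` the Gram matrices of
`M M^{*ω}` and `M + M^{*ω}` (`psi_shiftProd`). All specializations of `Φ_M` are therefore obtained
by mapping the entries of one matrix. In particular the substitution `t = (σ - s)(τ - s)` removes
the term `s ^ 2 J` and leaves a linear pencil in `s` (`charpoly_eval_eq_pfaffian`). Finally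
`Φ_{M^{*ω}} = Φ_M` holds because the squares and the leading coefficients agree, and then
`Φ_M(s, 0)` is the determinant of `M - s` because `ω(v, (M^{*ω} - s)(M - s) w)` is the pullback of
`ω` by `M - s`.
-/

namespace Symplectic

section Pfaffian

/-! ### The Pfaffian as a sum over all permutations -/

/-- A square matrix is alternating if it is skew-symmetric with zero diagonal (the second condition
is not redundant in characteristic two). -/
def IsAlternating {ι R : Type*} [CommRing R] (A : Matrix ι ι R) : Prop :=
  (∀ i, A i i = 0) ∧ ∀ i j, A j i = -A i j

/-- The sum defining the Pfaffian, extended over all permutations of the index set. It makes sense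
for every matrix, and equals `2 ^ n * n!` times the Pfaffian on alternating ones. -/
def fullPfaffian {R : Type*} [CommRing R] {n : ℕ}
    (A : Matrix (Fin n × Fin 2) (Fin n × Fin 2) R) : R :=
  ∑ σ : Equiv.Perm (Fin n × Fin 2),
    ((Equiv.Perm.sign σ : ℤ) : R) * ∏ i, A (σ (i, 0)) (σ (i, 1))

/-- The condition selecting one permutation for each perfect matching. -/
def IsCanonical {n : ℕ} (σ : Equiv.Perm (Fin n × Fin 2)) : Prop :=
  (∀ i, toLex (σ (i, 0)) < toLex (σ (i, 1))) ∧
    ∀ i j, i < j → toLex (σ (i, 0)) < toLex (σ (j, 0))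

variable {R : Type*} [CommRing R] {n : ℕ}

theorem perm_fin_two_cases (e : Equiv.Perm (Fin 2)) : e = 1 ∨ e = Equiv.swap 0 1 := by
  revert e; decide

theorem sign_prodShear (π : Equiv.Perm (Fin n)) (ε : Fin n → Equiv.Perm (Fin 2)) :
    Equiv.Perm.sign (Equiv.prodShear π ε : Equiv.Perm (Fin n × Fin 2)) =
      ∏ i, Equiv.Perm.sign (ε i) := by
  have h : (Equiv.prodShear π ε : Equiv.Perm (Fin n × Fin 2)) =
      Equiv.prodCongrLeft (fun _ : Fin 2 => π) * Equiv.prodCongrRight ε := by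
    ext ⟨i, a⟩ <;> rfl
  rw [h, Equiv.Perm.sign_mul, Equiv.Perm.sign_prodCongrLeft, Equiv.Perm.sign_prodCongrRight]
  simp

/-- The summand of the Pfaffian depends only on the perfect matching: it does not change when the
pairs are permuted or the two elements of a pair are exchanged. -/
theorem summand_mul_prodShear {A : Matrix (Fin n × Fin 2) (Fin n × Fin 2) R}
    (hA : IsAlternating A) (σ : Equiv.Perm (Fin n × Fin 2)) (π : Equiv.Perm (Fin n))
    (ε : Fin n → Equiv.Perm (Fin 2)) :
    ((Equiv.Perm.sign (σ * Equiv.prodShear π ε) : ℤ) : R) *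
        ∏ i, A ((σ * Equiv.prodShear π ε) (i, 0)) ((σ * Equiv.prodShear π ε) (i, 1)) =
      ((Equiv.Perm.sign σ : ℤ) : R) * ∏ i, A (σ (i, 0)) (σ (i, 1)) := by
  have key : ∀ i, A (σ (π i, ε i 0)) (σ (π i, ε i 1)) =
      ((Equiv.Perm.sign (ε i) : ℤ) : R) * A (σ (π i, 0)) (σ (π i, 1)) := by
    intro i
    rcases perm_fin_two_cases (ε i) with h | h
    · simp [h]
    · rw [h, Equiv.swap_apply_left, Equiv.swap_apply_right, Equiv.Perm.sign_swap (by decide)]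
      simp [hA.2 (σ (π i, 0)) (σ (π i, 1))]
  have hsq : ((∏ i, ((Equiv.Perm.sign (ε i) : ℤ) : R)) *
      ∏ i, ((Equiv.Perm.sign (ε i) : ℤ) : R)) = 1 := by
    rw [← Finset.prod_mul_distrib]
    refine Finset.prod_eq_one fun i _ => ?_
    rcases Int.units_eq_one_or (Equiv.Perm.sign (ε i)) with h | h <;> simp [h]
  have hprod : ∏ i, A ((σ * Equiv.prodShear π ε) (i, 0)) ((σ * Equiv.prodShear π ε) (i, 1)) =
      (∏ i, ((Equiv.Perm.sign (ε i) : ℤ) : R)) * ∏ i, A (σ (i, 0)) (σ (i, 1)) := by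
    rw [← Equiv.prod_comp π (fun i => A (σ (i, 0)) (σ (i, 1))), ← Finset.prod_mul_distrib]
    exact Finset.prod_congr rfl fun i _ => key i
  rw [hprod, Equiv.Perm.sign_mul, sign_prodShear]
  push_cast
  linear_combination ((Equiv.Perm.sign σ : ℤ) : R) * (∏ i, A (σ (i, 0)) (σ (i, 1))) * hsq

/-- Each perfect matching, with its pairs and the elements of each pair ordered arbitrarily, can be
brought into canonical order in exactly one way. -/
theorem existsUnique_isCanonical (σ : Equiv.Perm (Fin n × Fin 2)) :
    ∃! h : Equiv.Perm (Fin n) × (Fin n → Equiv.Perm (Fin 2)),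
      IsCanonical (σ * Equiv.prodShear h.1 h.2) := by
  classical
  -- `ε₀ i` sorts the `i`-th pair, `g i` is its smaller element, and sorting `g` orders the pairs.
  let ε₀ : Fin n → Equiv.Perm (Fin 2) := fun i =>
    if toLex (σ (i, 0)) < toLex (σ (i, 1)) then 1 else Equiv.swap 0 1
  have hne : ∀ i, toLex (σ (i, 0)) ≠ toLex (σ (i, 1)) := fun i h => by
    have := σ.injective (toLex.injective h)
    simp at this
  have hε : ∀ i e, toLex (σ (i, e 0)) < toLex (σ (i, e 1)) ↔ e = ε₀ i := by
    intro i e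
    have h01 : (1 : Equiv.Perm (Fin 2)) ≠ Equiv.swap 0 1 := by decide
    by_cases h : toLex (σ (i, 0)) < toLex (σ (i, 1))
    · rcases perm_fin_two_cases e with rfl | rfl
      · simp [ε₀, h]
      · simp [ε₀, h, h01.symm, h.le]
    · have h' := lt_of_le_of_ne (not_lt.1 h) (hne i).symm
      rcases perm_fin_two_cases e with rfl | rfl
      · simp [ε₀, h, h01]
      · simp [ε₀, h, h']
  let g : Fin n → Lex (Fin n × Fin 2) := fun i => toLex (σ (i, ε₀ i 0))
  have hg : Function.Injective g := fun i j h =>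
    congrArg Prod.fst (σ.injective (toLex.injective h))
  refine ⟨(Tuple.sort g, fun i => ε₀ (Tuple.sort g i)), ⟨fun i => ?_, fun i j hij => ?_⟩, ?_⟩
  · exact (hε _ _).2 rfl
  · exact (Tuple.monotone_sort g).strictMono_of_injective
      (hg.comp (Tuple.sort g).injective) hij
  · rintro ⟨π, ε⟩ ⟨h₁, h₂⟩
    have he : ∀ i, ε i = ε₀ (π i) := fun i => (hε _ _).1 (h₁ i)
    have hmono : StrictMono (g ∘ π) := by
      intro i j hij
      have := h₂ i j hij
      simpa [g, ← he] using this
    have hπ : π = Tuple.sort g := by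
      have := Tuple.unique_monotone hmono.monotone (Tuple.monotone_sort g)
      exact Equiv.ext fun i => hg (congrFun this i)
    subst hπ
    exact Prod.ext rfl (funext he)

/-- Each perfect matching is counted `2 ^ n * n!` times in the full sum. -/
theorem fullPfaffian_eq {A : Matrix (Fin n × Fin 2) (Fin n × Fin 2) R} (hA : IsAlternating A) :
    fullPfaffian A =
      (Fintype.card (Equiv.Perm (Fin n) × (Fin n → Equiv.Perm (Fin 2))) : R) * pfaffian A := by
  classical
  let f : Equiv.Perm (Fin n × Fin 2) → R := fun σ =>
    ((Equiv.Perm.sign σ : ℤ) : R) * ∏ i, A (σ (i, 0)) (σ (i, 1))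
  let H := Equiv.Perm (Fin n) × (Fin n → Equiv.Perm (Fin 2))
  let s : H → Equiv.Perm (Fin n × Fin 2) := fun h => Equiv.prodShear h.1 h.2
  have hpf : pfaffian A = ∑ σ, if IsCanonical σ then f σ else 0 := by
    rw [← Finset.sum_filter]
    exact Finset.sum_congr (Finset.filter_congr fun _ _ => Iff.rfl) fun _ _ => rfl
  calc
    fullPfaffian A = ∑ σ, f σ := rfl
    _ = ∑ σ, ∑ h : H, if IsCanonical (σ * s h) then f (σ * s h) else 0 := by
      refine Finset.sum_congr rfl fun σ _ => ?_
      obtain ⟨h, hh, huniq⟩ := existsUnique_isCanonical σ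
      rw [Finset.sum_eq_single h, if_pos hh]
      · exact (summand_mul_prodShear hA σ h.1 h.2).symm
      · exact fun h' _ hne => if_neg fun hc => hne (huniq h' hc)
      · simp
    _ = ∑ h : H, ∑ σ, if IsCanonical (σ * s h) then f (σ * s h) else 0 := Finset.sum_comm
    _ = ∑ _h : H, pfaffian A := by
      refine Finset.sum_congr rfl fun h _ => ?_
      rw [hpf]
      exact Equiv.sum_comp (Equiv.mulRight (s h)) fun σ => if IsCanonical σ then f σ else 0
    _ = _ := by simp [H]

open Matrix in
/-- The full sum transforms under congruence by the determinant. As for the multiplicativity of the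
determinant, expanding the products gives a sum over all maps of the index set to itself, in which
the inner sum is the determinant of a matrix of rows of `B`. -/
theorem fullPfaffian_congr (A B : Matrix (Fin n × Fin 2) (Fin n × Fin 2) R) :
    fullPfaffian (Bᵀ * A * B) = B.det * fullPfaffian A := by
  classical
  -- Sums over pairs of indices are written as sums over maps from `Fin 2`, so that the choices made
  -- for the `n` factors assemble to a map from `Fin n × Fin 2`.
  have hentry : ∀ p q, (Bᵀ * A * B) p q = ∑ x : Fin 2 → Fin n × Fin 2,
      A (x 0) (x 1) * (B (x 0) p * B (x 1) q) := by
    intro p q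
    rw [← (finTwoArrowEquiv _).symm.sum_comp, Fintype.sum_prod_type, Finset.sum_comm]
    simp only [mul_apply, transpose_apply, Finset.sum_mul, finTwoArrowEquiv_symm_apply]
    refine Finset.sum_congr rfl fun x _ => Finset.sum_congr rfl fun y _ => ?_
    simp
    ring
  have hsum : ∀ F : (Fin n × Fin 2 → Fin n × Fin 2) → R,
      ∑ x : Fin n → Fin 2 → Fin n × Fin 2, F (Function.uncurry x) = ∑ f, F f :=
    fun F => (Equiv.curry _ _ _).symm.sum_comp F
  have hdet : ∀ f : Fin n × Fin 2 → Fin n × Fin 2,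
      ∑ σ : Equiv.Perm (Fin n × Fin 2), ((Equiv.Perm.sign σ : ℤ) : R) * ∏ x, B (f x) (σ x) =
        (B.submatrix f id).det := by
    intro f
    rw [← det_transpose, det_apply']
    rfl
  have hperm : ∀ F : (Fin n × Fin 2 → Fin n × Fin 2) → R,
      (∀ f, ¬ Function.Bijective f → F f = 0) →
        ∑ f, F f = ∑ σ : Equiv.Perm (Fin n × Fin 2), F σ := by
    intro F hF
    rw [← Finset.sum_subset (Finset.filter_subset Function.Bijective Finset.univ)]
    · exact Finset.sum_bij (fun p h ↦ Equiv.ofBijective p (Finset.mem_filter.1 h).2)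
        (fun _ _ ↦ Finset.mem_univ _) (fun _ _ _ _ h ↦ by injection h)
        (fun b _ ↦ ⟨b, Finset.mem_filter.2 ⟨Finset.mem_univ _, b.bijective⟩,
          DFunLike.coe_injective rfl⟩) fun _ _ ↦ rfl
    · intro f _ hf
      exact hF f fun h => hf (Finset.mem_filter.2 ⟨Finset.mem_univ _, h⟩)
  calc
    fullPfaffian (Bᵀ * A * B) = ∑ σ : Equiv.Perm (Fin n × Fin 2), ((Equiv.Perm.sign σ : ℤ) : R) *
        ∑ f : Fin n × Fin 2 → Fin n × Fin 2,
          (∏ i, A (f (i, 0)) (f (i, 1))) * ∏ x, B (f x) (σ x) := by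
      refine Finset.sum_congr rfl fun σ _ => ?_
      congr 1
      rw [← hsum]
      simp only [hentry, Finset.prod_univ_sum, Fintype.piFinset_univ]
      refine Finset.sum_congr rfl fun x _ => ?_
      simp [Finset.prod_mul_distrib, Fintype.prod_prod_type]
    _ = ∑ f : Fin n × Fin 2 → Fin n × Fin 2,
          (∏ i, A (f (i, 0)) (f (i, 1))) * (B.submatrix f id).det := by
      simp only [Finset.mul_sum, ← hdet]
      rw [Finset.sum_comm]
      exact Finset.sum_congr rfl fun f _ => Finset.sum_congr rfl fun σ _ => by ring
    _ = ∑ f : Equiv.Perm (Fin n × Fin 2),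
          (∏ i, A (f (i, 0)) (f (i, 1))) * (B.submatrix f id).det := by
      refine hperm (fun f => (∏ i, A (f (i, 0)) (f (i, 1))) * (B.submatrix f id).det) ?_
      intro f hf
      rw [← Finite.injective_iff_bijective, Function.Injective] at hf
      push Not at hf
      obtain ⟨i, j, hij, hne⟩ := hf
      have : (B.submatrix f id).det = 0 := det_zero_of_row_eq hne (by ext; simp [hij])
      simp [this]
    _ = B.det * fullPfaffian A := by
      rw [fullPfaffian, Finset.mul_sum]
      refine Finset.sum_congr rfl fun f _ => ?_
      rw [det_permute]
      ring

/-! ### Congruence and squares of Pfaffians -/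

theorem pfaffian_map {S : Type*} [CommRing S] (φ : R →+* S)
    (A : Matrix (Fin n × Fin 2) (Fin n × Fin 2) R) : pfaffian (A.map φ) = φ (pfaffian A) := by
  simp [pfaffian, map_sum, map_mul, map_prod]

theorem IsAlternating.map {ι S : Type*} [CommRing S] {A : Matrix ι ι R} (hA : IsAlternating A)
    (φ : R →+* S) : IsAlternating (A.map φ) :=
  ⟨fun i => by simp [hA.1], fun i j => by simp [hA.2 i j]⟩

open Matrix in
theorem IsAlternating.congr {ι κ : Type*} [Fintype ι] {A : Matrix ι ι R} (hA : IsAlternating A)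
    (B : Matrix ι κ R) : IsAlternating (Bᵀ * A * B) := by
  classical
  have key : ∀ i j, (Bᵀ * A * B) i j = ∑ x, ∑ y, B x i * A x y * B y j := by
    intro i j
    simp only [mul_apply, transpose_apply, Finset.sum_mul]
    exact Finset.sum_comm
  refine ⟨fun i => ?_, fun i j => ?_⟩
  -- Dividing by two is not allowed: the terms `(x, y)` and `(y, x)` cancel instead.
  · rw [key, ← Finset.sum_product']
    refine Finset.sum_involution (fun p _ => p.swap) ?_ ?_ ?_ ?_
    · rintro ⟨x, y⟩ -
      simp only [Prod.swap_prod_mk]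
      rw [hA.2 x y]; ring
    · rintro ⟨x, y⟩ - h hs
      simp only [Prod.swap_prod_mk, Prod.mk.injEq] at hs
      apply h
      simp [hs.1, hA.1]
    · simp
    · simp
  · rw [key, key, Finset.sum_comm, ← Finset.sum_neg_distrib]
    refine Finset.sum_congr rfl fun x _ => ?_
    rw [← Finset.sum_neg_distrib]
    refine Finset.sum_congr rfl fun y _ => ?_
    rw [hA.2 x y]; ring

/-- Every alternating matrix lifts to one over a polynomial ring with integer coefficients. -/
theorem exists_alternating_lift (A : Matrix (Fin n × Fin 2) (Fin n × Fin 2) R)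
    (hA : IsAlternating A) :
    ∃ A' : Matrix (Fin n × Fin 2) (Fin n × Fin 2) (MvPolynomial R ℤ), IsAlternating A' ∧
      A'.map (MvPolynomial.aeval (id : R → R)).toRingHom = A := by
  refine ⟨Matrix.of fun i j => if toLex i < toLex j then MvPolynomial.X (A i j) else
    if toLex j < toLex i then -MvPolynomial.X (A j i) else 0, ⟨fun i => by simp, fun i j => ?_⟩, ?_⟩
  · rcases lt_trichotomy (toLex i) (toLex j) with h | h | h
    · simp [h, h.not_gt]
    · simp [h]
    · simp [h, h.not_gt]
  · ext i j
    rcases lt_trichotomy (toLex i) (toLex j) with h | h | h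
    · simp [h]
    · obtain rfl := toLex.injective h
      simp [hA.1]
    · simp [h, h.not_gt, hA.2 j i]

open Matrix in
/-- `Pf(Bᵀ A B) = det B * Pf A`. Both sides are integral polynomials in the entries, so it suffices
to treat polynomial rings over `ℤ`, where the factor `2 ^ n * n!` can be cancelled. -/
theorem pfaffian_congr {A : Matrix (Fin n × Fin 2) (Fin n × Fin 2) R} (hA : IsAlternating A)
    (B : Matrix (Fin n × Fin 2) (Fin n × Fin 2) R) :
    pfaffian (Bᵀ * A * B) = B.det * pfaffian A := by
  obtain ⟨A', hA', rfl⟩ := exists_alternating_lift A hA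
  set φ : MvPolynomial R ℤ →+* R := (MvPolynomial.aeval (id : R → R)).toRingHom
  obtain ⟨B', rfl⟩ : ∃ B' : Matrix (Fin n × Fin 2) (Fin n × Fin 2) (MvPolynomial R ℤ),
      B'.map φ = B := ⟨Matrix.of fun i j => MvPolynomial.X (B i j), by ext; simp [φ]⟩
  have h := fullPfaffian_congr A' B'
  rw [fullPfaffian_eq hA', fullPfaffian_eq (hA'.congr B')] at h
  -- `MvPolynomial R ℤ` is a domain of characteristic zero.
  have h0 : (Fintype.card (Equiv.Perm (Fin n) × (Fin n → Equiv.Perm (Fin 2))) :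
      MvPolynomial R ℤ) ≠ 0 := Nat.cast_ne_zero.2 Fintype.card_ne_zero
  have h' : pfaffian (B'ᵀ * A' * B') = B'.det * pfaffian A' :=
    mul_left_cancel₀ h0 (by rw [h]; ring)
  rw [← transpose_map, ← Matrix.map_mul, ← Matrix.map_mul, pfaffian_map, pfaffian_map, h', map_mul,
    RingHom.map_det]
  rfl

/-! ### Symplectic bases -/

/-- The matrix of a symplectic form in a symplectic basis `(e₁, f₁, …, eₙ, fₙ)`. -/
def stdMatrix (R : Type*) [CommRing R] (n : ℕ) : Matrix (Fin n × Fin 2) (Fin n × Fin 2) R :=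
  Matrix.of fun p q => if p.1 = q.1 then !![0, 1; -1, 0] p.2 q.2 else 0

theorem stdMatrix_isAlternating : IsAlternating (stdMatrix R n) := by
  refine ⟨fun ⟨i, a⟩ => ?_, fun ⟨i, a⟩ ⟨j, b⟩ => ?_⟩
  · fin_cases a <;> simp [stdMatrix]
  · by_cases h : i = j
    · subst h
      fin_cases a <;> fin_cases b <;> simp [stdMatrix]
    · simp [stdMatrix, h, Ne.symm h]

theorem stdMatrix_map {S : Type*} [CommRing S] (φ : R →+* S) :
    (stdMatrix R n).map φ = stdMatrix S n := by
  ext ⟨i, a⟩ ⟨j, b⟩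
  by_cases h : i = j
  · fin_cases a <;> fin_cases b <;> simp [stdMatrix, h]
  · simp [stdMatrix, h]

theorem stdMatrix_eq_submatrix : stdMatrix R n =
    (Matrix.blockDiagonal fun _ : Fin n => (!![0, 1; -1, 0] : Matrix (Fin 2) (Fin 2) R)).submatrix
      (Equiv.prodComm _ _) (Equiv.prodComm _ _) := by
  ext ⟨i, a⟩ ⟨j, b⟩
  simp [stdMatrix, Matrix.blockDiagonal_apply]

theorem det_stdMatrix : (stdMatrix R n).det = 1 := by
  rw [stdMatrix_eq_submatrix, Matrix.det_submatrix_equiv_self, Matrix.det_blockDiagonal]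
  simp [Matrix.det_fin_two]

/-- Only the identity permutation contributes to the Pfaffian of the standard matrix. -/
theorem pfaffian_stdMatrix : pfaffian (stdMatrix R n) = 1 := by
  classical
  rw [pfaffian, Finset.sum_eq_single 1]
  · simp [stdMatrix]
  · intro σ hσ hne
    obtain ⟨h₁, h₂⟩ := (Finset.mem_filter.1 hσ).2
    by_contra h0
    have hentry : ∀ i, stdMatrix R n (σ (i, 0)) (σ (i, 1)) ≠ 0 := fun i hi =>
      h0 (mul_eq_zero_of_right _ (Finset.prod_eq_zero (Finset.mem_univ i) hi))
    have hfst : ∀ i, (σ (i, 0)).1 = (σ (i, 1)).1 := fun i => by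
      by_contra h
      exact hentry i (by simp [stdMatrix, h])
    have hsnd : ∀ i, (σ (i, 0)).2 = 0 ∧ (σ (i, 1)).2 = 1 := fun i => by
      have := h₁ i
      rw [Prod.Lex.lt_iff] at this
      simp only [ofLex_toLex, hfst i, lt_self_iff_false, true_and, false_or] at this
      omega
    have hmono : StrictMono fun i => (σ (i, 0)).1 := fun i j hij => by
      have := h₂ i j hij
      rw [Prod.Lex.lt_iff] at this
      simpa [(hsnd i).1, (hsnd j).1] using this
    have hid : ∀ i, (σ (i, 0)).1 = i := fun i => by
      have h := Subsingleton.elim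
        (StrictMono.orderIsoOfSurjective _ hmono (Finite.surjective_of_injective hmono.injective))
        (OrderIso.refl _)
      exact congrArg (fun e : Fin n ≃o Fin n => e i) h
    apply hne
    ext1 ⟨i, a⟩
    fin_cases a
    · exact Prod.ext (hid i) (hsnd i).1
    · exact Prod.ext ((hfst i).symm.trans (hid i)) (hsnd i).2
  · intro h
    refine absurd (Finset.mem_filter.2 ⟨Finset.mem_univ _, ?_, ?_⟩) h
    · intro i
      simp [Prod.Lex.lt_iff]
    · intro i j hij
      simp [Prod.Lex.lt_iff, hij]

/-- The reordering `(e₁, …, eₙ, f₁, …, fₙ) ↦ (e₁, f₁, …, eₙ, fₙ)` of indices. -/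
def interleaveEquiv (n : ℕ) : Fin n ⊕ Fin n ≃ Fin n × Fin 2 where
  toFun := Sum.elim (fun i => (i, 0)) fun i => (i, 1)
  invFun p := if p.2 = 0 then .inl p.1 else .inr p.1
  left_inv x := by cases x <;> simp
  right_inv := by rintro ⟨i, a⟩; fin_cases a <;> simp

theorem coe_reindex_interleaveEquiv {V : Type*} [AddCommGroup V] [Module R V]
    (b : Module.Basis (Fin n ⊕ Fin n) R V) : ⇑(b.reindex (interleaveEquiv n)) = interleave b := by
  ext ⟨i, a⟩
  fin_cases a <;> simp [interleaveEquiv, interleave]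

theorem IsSymplecticBasis.apply_interleave {V : Type*} [AddCommGroup V] [Module R V]
    {ω : LinearMap.BilinForm R V} (hω : ω.IsAlt) {b : Module.Basis (Fin n ⊕ Fin n) R V}
    (hb : IsSymplecticBasis ω b) (p q : Fin n × Fin 2) :
    ω (interleave b p) (interleave b q) = stdMatrix R n p q := by
  obtain ⟨i, a⟩ := p
  obtain ⟨j, c⟩ := q
  obtain ⟨h₁, h₂, h₃⟩ := hb i j
  have h₄ : ω (b (.inr i)) (b (.inl j)) = -if i = j then 1 else 0 := by
    rw [← LinearMap.IsAlt.neg hω, (hb j i).2.2]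
    simp [eq_comm]
  by_cases h : i = j <;> fin_cases a <;> fin_cases c <;>
    simp_all [interleave, stdMatrix]

section Field

variable {K V : Type*} [Field K] [AddCommGroup V] [Module K V]

/-- A symplectic family of `k` pairs. -/
def IsSymplecticFamily (ω : LinearMap.BilinForm K V) {k : ℕ} (e f : Fin k → V) : Prop :=
  ∀ i j, ω (e i) (e j) = 0 ∧ ω (f i) (f j) = 0 ∧ ω (e i) (f j) = if i = j then 1 else 0

/-- A symplectic family of fewer than `n` pairs can be extended: for dimension reasons some nonzero
vector is orthogonal to it, and this vector can be paired with another one. -/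
theorem exists_isSymplecticFamily [FiniteDimensional K V] (hn : Module.finrank K V = 2 * n)
    {ω : LinearMap.BilinForm K V} (hω : ω.IsAlt) (hnd : ∀ v, (∀ w, ω v w = 0) → v = 0) :
    ∀ k ≤ n, ∃ e f : Fin k → V, IsSymplecticFamily ω e f := by
  intro k
  induction k with
  | zero => exact fun _ => ⟨Fin.elim0, Fin.elim0, fun i => i.elim0⟩
  | succ k ih =>
    intro hk
    obtain ⟨e, f, hef⟩ := ih (by omega)
    have hneg : ∀ v w, ω v w = -ω w v := fun v w => (LinearMap.IsAlt.neg hω w v).symm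
    let L : V →ₗ[K] (Fin k → K) × (Fin k → K) :=
      (LinearMap.pi fun i => ω.flip (e i)).prod (LinearMap.pi fun i => ω.flip (f i))
    obtain ⟨v, hv, hv0⟩ := (Submodule.ne_bot_iff _).1
      (LinearMap.ker_ne_bot_of_finrank_lt (f := L) (by simp [hn]; omega))
    have hve : ∀ i, ω v (e i) = 0 := fun i => congrFun (congrArg Prod.fst hv) i
    have hvf : ∀ i, ω v (f i) = 0 := fun i => congrFun (congrArg Prod.snd hv) i
    obtain ⟨w, hw⟩ : ∃ w, ω v w ≠ 0 := by
      by_contra! h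
      exact hv0 (hnd v h)
    -- The projection of `w` to the orthogonal complement of the family, scaled to `ω(v, w') = 1`.
    let w' := (ω v w)⁻¹ • (w - ∑ i, ω w (f i) • e i + ∑ i, ω w (e i) • f i)
    have hfe : ∀ i j, ω (f i) (e j) = -if i = j then 1 else 0 := fun i j => by
      rw [hneg, (hef j i).2.2]; simp [eq_comm]
    have hwe : ∀ j, ω w' (e j) = 0 := fun j => by simp [w', (hef _ j).1, hfe]
    have hwf : ∀ j, ω w' (f j) = 0 := fun j => by simp [w', (hef _ j).2.1, (hef _ j).2.2]
    have hvw : ω v w' = 1 := by simp [w', hve, hvf, hw]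
    refine ⟨Fin.cons v e, Fin.cons w' f, fun i j => ?_⟩
    refine Fin.cases ?_ (fun i => ?_) i <;> refine Fin.cases ?_ (fun j => ?_) j
    · simp [hω.self_eq_zero, hvw]
    · simp [hve, hwf, hvf, (Fin.succ_ne_zero j).symm]
    · simp [hneg _ v, hneg _ w', hve, hwf, hwe]
    · simpa using hef i j

theorem IsSymplecticFamily.linearIndependent {ω : LinearMap.BilinForm K V} (hω : ω.IsAlt)
    {e f : Fin n → V} (hef : IsSymplecticFamily ω e f) : LinearIndependent K (Sum.elim e f) := by
  have hfe : ∀ i j, ω (f i) (e j) = -if i = j then 1 else 0 := fun i j => by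
    rw [← LinearMap.IsAlt.neg hω, (hef j i).2.2]; simp [eq_comm]
  rw [Fintype.linearIndependent_iff]
  intro c hc
  rw [Fintype.sum_sum_type] at hc
  rintro (j | j)
  · have := congrArg (fun x => ω x (f j)) hc
    simpa [(hef _ j).2.1, (hef _ j).2.2] using this
  · have := congrArg (fun x => ω x (e j)) hc
    simpa [(hef _ j).1, hfe] using this

theorem exists_isSymplecticBasis [FiniteDimensional K V] (hn : Module.finrank K V = 2 * n)
    {ω : LinearMap.BilinForm K V} (hω : ω.IsAlt) (hnd : ∀ v, (∀ w, ω v w = 0) → v = 0) :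
    ∃ b : Module.Basis (Fin n ⊕ Fin n) K V, IsSymplecticBasis ω b := by
  obtain ⟨e, f, hef⟩ := exists_isSymplecticFamily hn hω hnd n le_rfl
  refine ⟨basisOfLinearIndependentOfCardEqFinrank' (Sum.elim e f) (hef.linearIndependent hω)
    (by simp [hn, two_mul]), fun i j => ?_⟩
  simpa using hef i j

end Field

/-! ### The square of the Pfaffian and the Pfaffian adjugate -/

theorem pfaffian_eq_zero_of_row {A : Matrix (Fin n × Fin 2) (Fin n × Fin 2) R} (i : Fin n × Fin 2)
    (hrow : ∀ j, A i j = 0) (hcol : ∀ j, A j i = 0) : pfaffian A = 0 := by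
  refine Finset.sum_eq_zero fun σ _ => mul_eq_zero_of_right _ ?_
  obtain ⟨⟨k, a⟩, rfl⟩ := σ.surjective i
  refine Finset.prod_eq_zero (Finset.mem_univ k) ?_
  fin_cases a
  · exact hrow _
  · exact hcol _

open Matrix in
/-- Over a field, a singular alternating matrix is congruent to one with a zero row, and a regular
one is congruent to the standard matrix. -/
theorem pfaffian_sq_of_field {F : Type*} [Field F]
    {A : Matrix (Fin n × Fin 2) (Fin n × Fin 2) F} (hA : IsAlternating A) :
    pfaffian A ^ 2 = A.det := by
  by_cases hdet : A.det = 0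
  · obtain ⟨v, hv, hAv⟩ := exists_mulVec_eq_zero_iff.2 hdet
    obtain ⟨i, hi⟩ := Function.ne_iff.1 hv
    -- A change of basis which makes the kernel vector `v` the `i`-th basis vector.
    let B := (1 : Matrix (Fin n × Fin 2) (Fin n × Fin 2) F).updateCol i v
    have hB : B.det = v i := by
      rw [← cramer_apply, cramer_one, Module.End.one_apply]
    have hcol : ∀ j, (Bᵀ * A * B) j i = 0 := fun j => by
      have h : (A * B) *ᵥ Pi.single i 1 = 0 := by
        rw [← mulVec_mulVec, mulVec_single_one]
        have : B.col i = v := by ext; simp [B]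
        rw [this, hAv]
      have h2 : (Bᵀ * A * B) *ᵥ Pi.single i 1 = 0 := by
        rw [Matrix.mul_assoc, ← mulVec_mulVec, h, mulVec_zero]
      rw [mulVec_single_one] at h2
      exact congrFun h2 j
    have h := pfaffian_congr hA B
    rw [pfaffian_eq_zero_of_row i
      (fun j => by rw [(hA.congr B).2 j i, hcol, neg_zero]) hcol, hB] at h
    have : pfaffian A = 0 := (mul_eq_zero.1 h.symm).resolve_left hi
    simp [this, hdet]
  · have halt : (Matrix.toBilin' A).IsAlt := fun v => by
      have h := (hA.congr (Matrix.of fun i (_ : Unit) => v i)).1 ()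
      rw [Matrix.mul_assoc] at h
      rw [Matrix.toBilin'_apply']
      exact h
    have hnd : ∀ v, (∀ w, Matrix.toBilin' A v w = 0) → v = 0 := fun v hv =>
      (Matrix.nondegenerate_of_det_ne_zero hdet).eq_zero_of_ortho
        fun w => by simpa [Matrix.toBilin'_apply'] using hv w
    obtain ⟨b, hb⟩ := exists_isSymplecticBasis (n := n) (by simp [mul_comm]) halt hnd
    let B : Matrix (Fin n × Fin 2) (Fin n × Fin 2) F := Matrix.of fun i p => interleave b p i
    have hB : Bᵀ * A * B = stdMatrix F n := by
      ext p q
      rw [← hb.apply_interleave halt, Matrix.toBilin'_apply', Matrix.mul_assoc]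
      rfl
    have h₁ := pfaffian_congr hA B
    have h₂ := congrArg Matrix.det hB
    rw [hB, pfaffian_stdMatrix] at h₁
    rw [det_mul, det_mul, det_transpose, det_stdMatrix] at h₂
    have h0 : B.det ≠ 0 := fun h => by simp [h] at h₁
    apply mul_left_cancel₀ (pow_ne_zero 2 h0)
    linear_combination (-1 - B.det * pfaffian A) * h₁ - h₂

theorem pfaffian_sq {A : Matrix (Fin n × Fin 2) (Fin n × Fin 2) R} (hA : IsAlternating A) :
    pfaffian A ^ 2 = A.det := by
  obtain ⟨A', hA', rfl⟩ := exists_alternating_lift A hA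
  let ι := algebraMap (MvPolynomial R ℤ) (FractionRing (MvPolynomial R ℤ))
  have h := pfaffian_sq_of_field (hA'.map ι)
  rw [pfaffian_map, ← map_pow, ← RingHom.mapMatrix_apply, ← RingHom.map_det] at h
  have h' : pfaffian A' ^ 2 = A'.det := IsFractionRing.injective _ _ h
  rw [pfaffian_map, ← map_pow, h', RingHom.map_det]
  rfl

/-- The matrix obtained from `A` on replacing its `i`-th row by `x` and its `i`-th column by `-x`,
with diagonal entry zero. -/
def replaceRow (A : Matrix (Fin n × Fin 2) (Fin n × Fin 2) R) (i : Fin n × Fin 2)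
    (x : Fin n × Fin 2 → R) : Matrix (Fin n × Fin 2) (Fin n × Fin 2) R :=
  Matrix.of fun p q => if p = i then if q = i then 0 else x q else if q = i then -x p else A p q

/-- The Pfaffian is a linear function of each row. -/
theorem exists_pfaffian_replaceRow (A : Matrix (Fin n × Fin 2) (Fin n × Fin 2) R)
    (i : Fin n × Fin 2) :
    ∃ c : Fin n × Fin 2 → R, ∀ x, pfaffian (replaceRow A i x) = ∑ q, x q * c q := by
  classical
  have key : ∀ σ : Equiv.Perm (Fin n × Fin 2), ∃ c : Fin n × Fin 2 → R, ∀ x,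
      ((Equiv.Perm.sign σ : ℤ) : R) * ∏ k, replaceRow A i x (σ (k, 0)) (σ (k, 1)) =
        ∑ q, x q * c q := by
    intro σ
    obtain ⟨⟨k, a⟩, rfl⟩ := σ.surjective i
    -- Only the factor of the pair containing the row depends on `x`.
    have hrest : ∀ x, ∏ l ∈ Finset.univ.erase k,
        replaceRow A (σ (k, a)) x (σ (l, 0)) (σ (l, 1)) =
          ∏ l ∈ Finset.univ.erase k, A (σ (l, 0)) (σ (l, 1)) := fun x =>
      Finset.prod_congr rfl fun l hl => by
        simp [replaceRow, (Finset.mem_erase.1 hl).1]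
    set r := ∏ l ∈ Finset.univ.erase k, A (σ (l, 0)) (σ (l, 1))
    fin_cases a
    · refine ⟨Pi.single (σ (k, 1)) (((Equiv.Perm.sign σ : ℤ) : R) * r), fun x => ?_⟩
      have h := hrest x
      simp only [Fin.zero_eta] at h ⊢
      rw [← Finset.mul_prod_erase _ _ (Finset.mem_univ k), h]
      simp [replaceRow, Pi.single_apply]
      ring
    · refine ⟨Pi.single (σ (k, 0)) (-((Equiv.Perm.sign σ : ℤ) : R) * r), fun x => ?_⟩
      have h := hrest x
      simp only [Fin.mk_one] at h ⊢
      rw [← Finset.mul_prod_erase _ _ (Finset.mem_univ k), h]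
      simp [replaceRow, Pi.single_apply]
      ring
  choose c hc using key
  refine ⟨fun q => ∑ σ : Equiv.Perm (Fin n × Fin 2) with
      (∀ i, toLex (σ (i, 0)) < toLex (σ (i, 1))) ∧
        (∀ i j, i < j → toLex (σ (i, 0)) < toLex (σ (j, 0))), c σ q, fun x => ?_⟩
  rw [pfaffian]
  simp only [hc, Finset.mul_sum]
  exact Finset.sum_comm

open Matrix in
/-- The Pfaffian adjugate. Replacing row `i` by row `j`, and likewise for columns, is a congruence
by a matrix of determinant `δᵢⱼ`; so expanding the Pfaffian along its rows gives a matrix which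
multiplies `A` to the scalar `Pf A`. -/
theorem exists_mul_eq_pfaffian {A : Matrix (Fin n × Fin 2) (Fin n × Fin 2) R}
    (hA : IsAlternating A) :
    ∃ P : Matrix (Fin n × Fin 2) (Fin n × Fin 2) R, P * A = pfaffian A • 1 := by
  classical
  choose c hc using exists_pfaffian_replaceRow A
  have key : ∀ i j, ∑ q, A j q * c i q = if i = j then pfaffian A else 0 := by
    intro i j
    rw [← hc]
    let f := Function.update id i j
    let B : Matrix (Fin n × Fin 2) (Fin n × Fin 2) R :=
      Matrix.of fun x p => if x = f p then 1 else 0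
    have hB : replaceRow A i (A j) = Bᵀ * A * B := by
      have h : Bᵀ * A * B = A.submatrix f f := by
        ext p q
        simp [B, mul_apply]
      rw [h]
      ext p q
      by_cases hp : p = i <;> by_cases hq : q = i <;>
        simp [replaceRow, f, hp, hq, hA.1]
      exact (hA.2 j p).symm
    rw [hB, pfaffian_congr hA]
    split_ifs with h
    · have : B = 1 := by
        subst h
        have hf : f = id := Function.update_eq_self i id
        ext x p
        simp [B, hf, one_apply]
      simp [this]
    · have : B.det = 0 := det_zero_of_column_eq h fun x => by simp [B, f, Ne.symm h]
      simp [this]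
  refine ⟨Matrix.of fun i q => -c i q, ?_⟩
  ext i j
  have h : (pfaffian A • (1 : Matrix (Fin n × Fin 2) (Fin n × Fin 2) R)) i j =
      if i = j then pfaffian A else 0 := by simp [one_apply]
  rw [h, ← key, mul_apply]
  exact Finset.sum_congr rfl fun q _ => by rw [of_apply, hA.2 j q]; ring

/-! ### Linear pencils of alternating matrices -/

/-- The matrix `A - X B` over the polynomial ring. -/
noncomputable def linearPencil {ι : Type*} (A B : Matrix ι ι R) : Matrix ι ι R[X] :=
  Matrix.of fun p q => Polynomial.C (A p q) - Polynomial.X * Polynomial.C (B p q)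

theorem linearPencil_isAlternating {ι : Type*} {A B : Matrix ι ι R} (hA : IsAlternating A)
    (hB : IsAlternating B) : IsAlternating (linearPencil A B) :=
  ⟨fun i => by simp [linearPencil, hA.1, hB.1],
    fun i j => by simp [linearPencil, hA.2 i j, hB.2 i j]; ring⟩

theorem natDegree_linear_le (a b : R) :
    (Polynomial.C a - Polynomial.X * Polynomial.C b).natDegree ≤ 1 := by
  compute_degree

variable (A B : Matrix (Fin n × Fin 2) (Fin n × Fin 2) R)

theorem natDegree_pfaffian_linearPencil_le : (pfaffian (linearPencil A B)).natDegree ≤ n := by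
  refine Polynomial.natDegree_sum_le_of_forall_le _ _ fun σ _ => ?_
  refine (Polynomial.natDegree_mul_le.trans (add_le_add (Polynomial.natDegree_intCast _).le
    (Polynomial.natDegree_prod_le _ _))).trans ?_
  rw [zero_add]
  exact (Finset.sum_le_card_nsmul _ _ 1 fun i _ => natDegree_linear_le _ _).trans (by simp)

theorem coeff_pfaffian_linearPencil : (pfaffian (linearPencil A B)).coeff n =
    (-1) ^ n * pfaffian B := by
  rw [pfaffian, Polynomial.finsetSum_coeff, pfaffian, Finset.mul_sum]
  refine Finset.sum_congr rfl fun σ _ => ?_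
  have h := Polynomial.coeff_prod_of_natDegree_le (s := Finset.univ)
    (fun i => linearPencil A B (σ (i, 0)) (σ (i, 1))) 1 fun i _ => natDegree_linear_le _ _
  rw [Finset.card_univ, Fintype.card_fin, mul_one] at h
  rw [← Polynomial.C_eq_intCast, Polynomial.coeff_C_mul, h]
  have : ∀ i, (linearPencil A B (σ (i, 0)) (σ (i, 1))).coeff 1 =
      -1 * B (σ (i, 0)) (σ (i, 1)) := fun i => by simp [linearPencil]
  simp only [this, Finset.prod_mul_distrib]
  simp
  ring

theorem coeff_zero_pfaffian_linearPencil :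
    (pfaffian (linearPencil A B)).coeff 0 = pfaffian A := by
  rw [← Polynomial.constantCoeff_apply, ← pfaffian_map]
  congr 1
  ext
  simp [linearPencil]

end Pfaffian

/-! ### The polynomial `ψ` and its basic properties -/

section Psi

variable {R V : Type*} [CommRing R] [AddCommGroup V] [Module R V] {n : ℕ}

theorem isAlternating_toMatrix {ι : Type*} [Fintype ι] [DecidableEq ι] {B : LinearMap.BilinForm R V}
    (hB : B.IsAlt) (c : Module.Basis ι R V) : IsAlternating (LinearMap.BilinForm.toMatrix c B) :=
  ⟨fun i => by rw [LinearMap.BilinForm.toMatrix_apply, hB.self_eq_zero],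
    fun i j => by simp only [LinearMap.BilinForm.toMatrix_apply]; rw [LinearMap.IsAlt.neg hB]⟩

theorem isAlt_of_toMatrix {ι : Type*} [Fintype ι] [DecidableEq ι] {B : LinearMap.BilinForm R V}
    (c : Module.Basis ι R V) (h : IsAlternating (LinearMap.BilinForm.toMatrix c B)) : B.IsAlt := by
  intro v
  obtain ⟨x, rfl⟩ := c.equivFun.symm.surjective v
  rw [← LinearMap.BilinForm.dotProduct_toMatrix_mulVec]
  have := (h.congr (Matrix.of fun i (_ : Unit) => x i)).1 ()
  rw [Matrix.mul_assoc] at this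
  exact this

theorem IsSymplecticBasis.toMatrix_eq {ω : LinearMap.BilinForm R V} (hω : ω.IsAlt)
    {b : Module.Basis (Fin n ⊕ Fin n) R V} (hb : IsSymplecticBasis ω b) :
    LinearMap.BilinForm.toMatrix (b.reindex (interleaveEquiv n)) ω = stdMatrix R n := by
  ext p q
  rw [LinearMap.BilinForm.toMatrix_apply, coe_reindex_interleaveEquiv, hb.apply_interleave hω]

theorem isSymplecticBasis_of_toMatrix_eq {ω : LinearMap.BilinForm R V}
    {c : Module.Basis (Fin n × Fin 2) R V} (hc : LinearMap.BilinForm.toMatrix c ω = stdMatrix R n) :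
    IsSymplecticBasis ω (c.reindex (interleaveEquiv n).symm) := by
  have h : ∀ p q, ω (c p) (c q) = stdMatrix R n p q := fun p q => by
    rw [← hc, LinearMap.BilinForm.toMatrix_apply]
  intro i j
  simp [interleaveEquiv, h, stdMatrix]

theorem pencil_interleave (ω : LinearMap.BilinForm R V) (A : Module.End R V)
    (b : Module.Basis (Fin n ⊕ Fin n) R V) :
    pencil ω A (interleave b) =
      linearPencil (LinearMap.BilinForm.toMatrix (b.reindex (interleaveEquiv n)) (ω.compRight A))
        (LinearMap.BilinForm.toMatrix (b.reindex (interleaveEquiv n)) ω) := by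
  ext p q : 2
  simp only [linearPencil, pencil, Matrix.of_apply, LinearMap.BilinForm.toMatrix_apply,
    coe_reindex_interleaveEquiv, LinearMap.BilinForm.compRight_apply]

open Matrix in
/-- The Pfaffian defining `ψ` does not depend on the symplectic basis: two such bases differ by a
matrix `B` with `Bᵀ J B = J`, and taking Pfaffians gives `det B = 1`. -/
theorem psi_eq_pfaffian [Nontrivial R] {ω : LinearMap.BilinForm R V} (hω : ω.IsAlt)
    {A : Module.End R V} (hA : (ω.compRight A).IsAlt) (c : Module.Basis (Fin n × Fin 2) R V)
    (hc : LinearMap.BilinForm.toMatrix c ω = stdMatrix R n) :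
    psi ω A = pfaffian
      (linearPencil (LinearMap.BilinForm.toMatrix c (ω.compRight A)) (stdMatrix R n)) := by
  have hex : ∃ (m : ℕ) (b : Module.Basis (Fin m ⊕ Fin m) R V), IsSymplecticBasis ω b :=
    ⟨n, _, isSymplecticBasis_of_toMatrix_eq hc⟩
  rw [psi, dif_pos hex]
  have key : ∀ (m : ℕ) (b : Module.Basis (Fin m ⊕ Fin m) R V), IsSymplecticBasis ω b →
      pfaffian (pencil ω A (interleave b)) =
        pfaffian
          (linearPencil (LinearMap.BilinForm.toMatrix c (ω.compRight A)) (stdMatrix R n)) := by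
    intro m b hb
    obtain rfl : m = n := by
      have h₁ := Module.finrank_eq_card_basis b
      have h₂ := Module.finrank_eq_card_basis c
      simp only [Fintype.card_sum, Fintype.card_fin, Fintype.card_prod] at h₁ h₂
      omega
    rw [pencil_interleave, hb.toMatrix_eq hω]
    set c' := b.reindex (interleaveEquiv m)
    have hc' : LinearMap.BilinForm.toMatrix c' ω = stdMatrix R m := hb.toMatrix_eq hω
    let B := c.toMatrix c'
    have h₁ : Bᵀ * stdMatrix R m * B = stdMatrix R m := by
      rw [← hc, LinearMap.BilinForm.toMatrix_mul_basis_toMatrix, hc', hc]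
    have h₂ : Bᵀ * LinearMap.BilinForm.toMatrix c (ω.compRight A) * B =
        LinearMap.BilinForm.toMatrix c' (ω.compRight A) :=
      LinearMap.BilinForm.toMatrix_mul_basis_toMatrix _ _ _
    have hdet : B.det = 1 := by
      have := pfaffian_congr stdMatrix_isAlternating B
      rw [h₁, pfaffian_stdMatrix, mul_one] at this
      exact this.symm
    have hmap : ∀ S T : Matrix (Fin m × Fin 2) (Fin m × Fin 2) R,
        linearPencil (Bᵀ * S * B) (Bᵀ * T * B) =
          (B.map Polynomial.C)ᵀ * linearPencil S T * B.map Polynomial.C := by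
      intro S T
      have h : ∀ S T : Matrix (Fin m × Fin 2) (Fin m × Fin 2) R, linearPencil S T =
          S.map Polynomial.C - (Polynomial.X : R[X]) • T.map Polynomial.C := fun _ _ => rfl
      rw [h, h, Matrix.map_mul, Matrix.map_mul, Matrix.map_mul, Matrix.map_mul, transpose_map]
      simp [Matrix.mul_sub, Matrix.sub_mul]
    rw [← h₂]
    conv_lhs => rw [← h₁]
    rw [hmap, pfaffian_congr (linearPencil_isAlternating (isAlternating_toMatrix hA c)
      stdMatrix_isAlternating), ← RingHom.mapMatrix_apply, ← RingHom.map_det, hdet, map_one,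
      one_mul]
  exact key _ _ hex.choose_spec.choose_spec

theorem linearPencil_compRight (ω : LinearMap.BilinForm R V) (A : Module.End R V)
    (c : Module.Basis (Fin n × Fin 2) R V) (hc : LinearMap.BilinForm.toMatrix c ω = stdMatrix R n) :
    linearPencil (LinearMap.BilinForm.toMatrix c (ω.compRight A)) (stdMatrix R n) =
      -stdMatrix R[X] n * (LinearMap.toMatrix c c A).charmatrix := by
  have h : ∀ S T : Matrix (Fin n × Fin 2) (Fin n × Fin 2) R, linearPencil S T =
      S.map Polynomial.C - (Polynomial.X : R[X]) • T.map Polynomial.C := fun _ _ => rfl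
  rw [h, LinearMap.BilinForm.toMatrix_compRight, hc, Matrix.map_mul, stdMatrix_map,
    Matrix.charmatrix, Matrix.scalar_apply, ← Matrix.smul_one_eq_diagonal, Matrix.mul_sub]
  simp
  abel

/-- The Gram matrix of `A - t` is `-J` times the characteristic matrix of `A`, and `det(-J) = 1`. -/
theorem psi_sq [Nontrivial R] [Module.Free R V] [Module.Finite R V] {ω : LinearMap.BilinForm R V}
    (hω : ω.IsAlt) {A : Module.End R V} (hA : (ω.compRight A).IsAlt)
    (c : Module.Basis (Fin n × Fin 2) R V) (hc : LinearMap.BilinForm.toMatrix c ω = stdMatrix R n) :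
    psi ω A ^ 2 = LinearMap.charpoly A := by
  rw [psi_eq_pfaffian hω hA c hc, pfaffian_sq (linearPencil_isAlternating
    (isAlternating_toMatrix hA c) stdMatrix_isAlternating), linearPencil_compRight ω A c hc,
    Matrix.det_mul, Matrix.det_neg, det_stdMatrix, ← LinearMap.charpoly_toMatrix A c,
    Matrix.charpoly]
  simp

/-- The Cayley-Hamilton theorem for `ψ`: by the Pfaffian adjugate, `ψ_A(t)` is a left multiple of
the characteristic matrix of `A`, and such multiples vanish on substituting `A` for `t`. -/
theorem aeval_self_psi [Nontrivial R] {ω : LinearMap.BilinForm R V}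
    (hω : ω.IsAlt) {A : Module.End R V} (hA : (ω.compRight A).IsAlt)
    (c : Module.Basis (Fin n × Fin 2) R V) (hc : LinearMap.BilinForm.toMatrix c ω = stdMatrix R n) :
    Polynomial.aeval A (psi ω A) = 0 := by
  obtain ⟨P, hP⟩ := exists_mul_eq_pfaffian (linearPencil_isAlternating
    (isAlternating_toMatrix hA c) (stdMatrix_isAlternating (R := R)))
  rw [← psi_eq_pfaffian hω hA c hc, linearPencil_compRight ω A c hc, ← Matrix.mul_assoc] at hP
  set T := LinearMap.toMatrix c c A
  have h := congrArg (fun N => (matPolyEquiv N).eval T) hP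
  simp only [map_mul, Matrix.matPolyEquiv_charmatrix, Polynomial.eval_mul_X_sub_C,
    matPolyEquiv_smul_one, Polynomial.eval_map] at h
  apply (LinearMap.toMatrixAlgEquiv c).injective
  rw [map_zero, ← Polynomial.aeval_algHom_apply (LinearMap.toMatrixAlgEquiv c)]
  exact h.symm

theorem coeff_psi [Nontrivial R] {ω : LinearMap.BilinForm R V} (hω : ω.IsAlt) {A : Module.End R V}
    (hA : (ω.compRight A).IsAlt) (c : Module.Basis (Fin n × Fin 2) R V)
    (hc : LinearMap.BilinForm.toMatrix c ω = stdMatrix R n) : (psi ω A).coeff n = (-1) ^ n := by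
  rw [psi_eq_pfaffian hω hA c hc, coeff_pfaffian_linearPencil, pfaffian_stdMatrix, mul_one]

theorem natDegree_psi [Nontrivial R] {ω : LinearMap.BilinForm R V} (hω : ω.IsAlt)
    {A : Module.End R V} (hA : (ω.compRight A).IsAlt) (c : Module.Basis (Fin n × Fin 2) R V)
    (hc : LinearMap.BilinForm.toMatrix c ω = stdMatrix R n) : (psi ω A).natDegree = n := by
  refine le_antisymm ?_ (Polynomial.le_natDegree_of_ne_zero ?_)
  · rw [psi_eq_pfaffian hω hA c hc]
    exact natDegree_pfaffian_linearPencil_le _ _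
  · rw [coeff_psi hω hA c hc]
    exact (isUnit_one.neg.pow n).ne_zero

/-- Comparison of the coefficients next to the leading ones in `ψ_A ^ 2 = φ_A`. -/
theorem two_mul_coeff_psi [Nontrivial R] [Module.Free R V] [Module.Finite R V]
    {ω : LinearMap.BilinForm R V} (hω : ω.IsAlt) {A : Module.End R V} (hA : (ω.compRight A).IsAlt)
    (c : Module.Basis (Fin n × Fin 2) R V) (hc : LinearMap.BilinForm.toMatrix c ω = stdMatrix R n)
    (hn : 1 ≤ n) :
    2 * (psi ω A).coeff (n - 1) = (-1) ^ (n - 1) * LinearMap.trace R V A := by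
  have hs : ((-1 : R) ^ n) * (-1) ^ n = 1 := by rw [← mul_pow]; simp
  -- The polynomial `(-1) ^ n * ψ` is monic and has the same square as `ψ`.
  set p := Polynomial.C ((-1 : R) ^ n) * psi ω A with hp
  have hdeg : p.natDegree = n := by
    rw [hp, Polynomial.natDegree_C_mul_of_mul_ne_zero, natDegree_psi hω hA c hc]
    rw [Polynomial.leadingCoeff, natDegree_psi hω hA c hc, coeff_psi hω hA c hc, hs]
    exact one_ne_zero
  have hmonic : p.Monic := by
    rw [Polynomial.Monic, Polynomial.leadingCoeff, hdeg, hp, Polynomial.coeff_C_mul,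
      coeff_psi hω hA c hc, hs]
  have hsq : p * p = LinearMap.charpoly A := by
    rw [← psi_sq hω hA c hc]
    have : (Polynomial.C ((-1 : R) ^ n)) * Polynomial.C ((-1 : R) ^ n) = 1 := by
      rw [← Polynomial.C_mul, hs, Polynomial.C_1]
    linear_combination (psi ω A) ^ 2 * this
  have hnext : p.nextCoeff = (-1) ^ n * (psi ω A).coeff (n - 1) := by
    rw [Polynomial.nextCoeff_of_natDegree_pos (by omega), hdeg, hp, Polynomial.coeff_C_mul]
  have htr : LinearMap.trace R V A = -(p.nextCoeff + p.nextCoeff) := by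
    rw [← hmonic.nextCoeff_mul hmonic, hsq, ← LinearMap.charpoly_toMatrix A c,
      ← Matrix.trace_eq_neg_charpoly_nextCoeff, LinearMap.trace_eq_matrix_trace R c]
  obtain ⟨m, rfl⟩ : ∃ m, n = m + 1 := ⟨n - 1, by omega⟩
  rw [htr, hnext]
  simp only [Nat.add_sub_cancel]
  have hm : ((-1 : R) ^ m) * (-1) ^ m = 1 := by rw [← mul_pow]; simp
  rw [pow_succ]
  linear_combination (-2 * (psi ω A).coeff m) * hm

end Psi

/-! ### The symplectic adjoint and extension of scalars -/

section Adjoint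

variable {K V : Type*} [Field K] [AddCommGroup V] [Module K V] {n : ℕ}
  {ω : LinearMap.BilinForm K V} (hω : IsSymplectic ω) (M : Module.End K V)

theorem IsSymplectic.isAlt {ω : LinearMap.BilinForm K V} (hω : IsSymplectic ω) : ω.IsAlt := hω.alt

theorem IsSymplectic.eq_of_forall {ω : LinearMap.BilinForm K V} (hω : IsSymplectic ω) {v w : V}
    (h : ∀ u, ω u v = ω u w) : v = w :=
  hω.bijective_flat.1 (LinearMap.ext h)

theorem apply_adj_right (v w : V) : ω v (adj ω hω M w) = ω (M v) w := by
  have h : flat ω hω (adj ω hω M w) = M.dualMap (flat ω hω w) := by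
    simp [adj]
  exact congrArg (fun f => f v) h

theorem apply_adj_left (v w : V) : ω (adj ω hω M v) w = ω v (M w) := by
  rw [← LinearMap.IsAlt.neg hω.isAlt, apply_adj_right, LinearMap.IsAlt.neg hω.isAlt]

theorem adj_adj : adj ω hω (adj ω hω M) = M :=
  LinearMap.ext fun v => hω.eq_of_forall fun u => by rw [apply_adj_right, apply_adj_left]

/-- `ω(v, M M^{*ω} v) = ω(M^{*ω} v, M^{*ω} v)`. -/
theorem isAlt_mul_adj : (ω.compRight (M * adj ω hω M)).IsAlt := fun v => by
  rw [LinearMap.BilinForm.compRight_apply, Module.End.mul_apply, ← apply_adj_left hω M, hω.alt]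

theorem isAlt_add_adj : (ω.compRight (M + adj ω hω M)).IsAlt := fun v => by
  rw [LinearMap.BilinForm.compRight_apply, LinearMap.add_apply, map_add, apply_adj_right,
    ← LinearMap.IsAlt.neg hω.isAlt v, add_neg_cancel]

theorem trace_adj [FiniteDimensional K V] :
    LinearMap.trace K V (adj ω hω M) = LinearMap.trace K V M := by
  rw [← LinearMap.trace_transpose' M, ← LinearMap.trace_conj' _ (flat ω hω).symm]
  rfl

theorem adj_conj {P : V ≃ₗ[K] V} (hP : P ∈ Sp ω) :
    adj ω hω (P.symm.toLinearMap ∘ₗ M ∘ₗ P.toLinearMap) =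
      P.symm.toLinearMap ∘ₗ adj ω hω M ∘ₗ P.toLinearMap := by
  have h : ∀ v w, ω v (P.symm w) = ω (P v) w := fun v w => by
    rw [← hP v (P.symm w), P.apply_symm_apply]
  have h' : ∀ v w, ω (P.symm v) w = ω v (P w) := fun v w => by
    rw [← hP (P.symm v) w, P.apply_symm_apply]
  refine LinearMap.ext fun v => hω.eq_of_forall fun u => ?_
  rw [apply_adj_right]
  simp [h, h', apply_adj_right]

variable (S : Type*) [CommRing S] [Algebra K S]

theorem toMatrix_baseChange_bilinForm (c : Module.Basis (Fin n × Fin 2) K V)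
    (B : LinearMap.BilinForm K V) :
    LinearMap.BilinForm.toMatrix (c.baseChange S) (LinearMap.BilinForm.baseChange S B) =
      (LinearMap.BilinForm.toMatrix c B).map (algebraMap K S) := by
  ext p q
  simp [LinearMap.BilinForm.toMatrix_apply, Algebra.algebraMap_eq_smul_one]

theorem toMatrix_baseChange_eq_stdMatrix {c : Module.Basis (Fin n × Fin 2) K V}
    (hc : LinearMap.BilinForm.toMatrix c ω = stdMatrix K n) :
    LinearMap.BilinForm.toMatrix (c.baseChange S) (LinearMap.BilinForm.baseChange S ω) =
      stdMatrix S n := by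
  rw [toMatrix_baseChange_bilinForm, hc, stdMatrix_map]

theorem isAlt_baseChange {c : Module.Basis (Fin n × Fin 2) K V}
    (hc : LinearMap.BilinForm.toMatrix c ω = stdMatrix K n) :
    (LinearMap.BilinForm.baseChange S ω).IsAlt :=
  isAlt_of_toMatrix (c.baseChange S)
    (by rw [toMatrix_baseChange_eq_stdMatrix S hc]; exact stdMatrix_isAlternating)

variable (s : S)

theorem shiftProd_eq : shiftProd ω hω M S s =
    LinearMap.baseChange S (M * adj ω hω M) - s • LinearMap.baseChange S (M + adj ω hω M) +
      s ^ 2 • 1 := by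
  rw [shiftProd, LinearMap.baseChange_mul, LinearMap.baseChange_add]
  ext v
  simp [sub_eq_add_neg, pow_two, mul_smul]
  abel

theorem toMatrix_compRight_shiftProd {c : Module.Basis (Fin n × Fin 2) K V}
    (hc : LinearMap.BilinForm.toMatrix c ω = stdMatrix K n) :
    LinearMap.BilinForm.toMatrix (c.baseChange S)
        ((LinearMap.BilinForm.baseChange S ω).compRight (shiftProd ω hω M S s)) =
      (LinearMap.BilinForm.toMatrix c (ω.compRight (M * adj ω hω M))).map (algebraMap K S) -
        s • (LinearMap.BilinForm.toMatrix c (ω.compRight (M + adj ω hω M))).map (algebraMap K S) +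
        s ^ 2 • stdMatrix S n := by
  rw [← toMatrix_baseChange_eq_stdMatrix S hc, ← toMatrix_baseChange_bilinForm,
    ← toMatrix_baseChange_bilinForm, shiftProd_eq]
  ext p q
  simp only [LinearMap.BilinForm.toMatrix_apply, Matrix.add_apply, Matrix.sub_apply,
    Matrix.smul_apply, smul_eq_mul, LinearMap.BilinForm.compRight_apply, LinearMap.add_apply,
    LinearMap.sub_apply, LinearMap.smul_apply, map_add, map_sub, map_smul, Module.End.one_apply,
    Module.Basis.baseChange_apply, LinearMap.baseChange_tmul,
    LinearMap.BilinForm.baseChange_tmul]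

theorem isAlt_compRight_shiftProd {c : Module.Basis (Fin n × Fin 2) K V}
    (hc : LinearMap.BilinForm.toMatrix c ω = stdMatrix K n) :
    ((LinearMap.BilinForm.baseChange S ω).compRight (shiftProd ω hω M S s)).IsAlt := by
  refine isAlt_of_toMatrix (c.baseChange S) ?_
  have h₁ := (isAlternating_toMatrix (isAlt_mul_adj hω M) c).map (algebraMap K S)
  have h₂ := (isAlternating_toMatrix (isAlt_add_adj hω M) c).map (algebraMap K S)
  have h₃ := stdMatrix_isAlternating (R := S) (n := n)
  rw [toMatrix_compRight_shiftProd hω M S s hc]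
  refine ⟨fun i => ?_, fun i j => ?_⟩
  · simp only [Matrix.add_apply, Matrix.sub_apply, Matrix.smul_apply, h₁.1, h₂.1, h₃.1]
    simp
  · simp only [Matrix.add_apply, Matrix.sub_apply, Matrix.smul_apply, h₁.2 i j, h₂.2 i j,
      h₃.2 i j, smul_eq_mul]
    ring

/-- An explicit form of `ψ` of `(M - s)(M^{*ω} - s)` for an element `s` of a `K`-algebra `S`; for the
variable of `K[s]` this is `Φ_M`. Since the entries come from `K` and `s`, it is compatible with
homomorphisms of such algebras. -/
theorem psi_shiftProd [Nontrivial S] {c : Module.Basis (Fin n × Fin 2) K V}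
    (hc : LinearMap.BilinForm.toMatrix c ω = stdMatrix K n) :
    psi (LinearMap.BilinForm.baseChange S ω) (shiftProd ω hω M S s) = pfaffian (linearPencil
      ((LinearMap.BilinForm.toMatrix c (ω.compRight (M * adj ω hω M))).map (algebraMap K S) -
        s • (LinearMap.BilinForm.toMatrix c (ω.compRight (M + adj ω hω M))).map (algebraMap K S) +
        s ^ 2 • stdMatrix S n) (stdMatrix S n)) := by
  rw [psi_eq_pfaffian (isAlt_baseChange S hc) (isAlt_compRight_shiftProd hω M S s hc)
    (c.baseChange S) (toMatrix_baseChange_eq_stdMatrix S hc),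
    toMatrix_compRight_shiftProd hω M S s hc]

end Adjoint

/-! ### The symplectic characteristic polynomial -/

section Charpoly

variable {K V : Type*} [Field K] [AddCommGroup V] [Module K V] {n : ℕ}
  {ω : LinearMap.BilinForm K V} (hω : IsSymplectic ω) (M : Module.End K V)

theorem IsSymplectic.exists_toMatrix_eq_stdMatrix [FiniteDimensional K V]
    (hn : Module.finrank K V = 2 * n) {ω : LinearMap.BilinForm K V} (hω : IsSymplectic ω) :
    ∃ c : Module.Basis (Fin n × Fin 2) K V,
      LinearMap.BilinForm.toMatrix c ω = stdMatrix K n := by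
  obtain ⟨b, hb⟩ := exists_isSymplecticBasis hn hω.isAlt fun v hv =>
    hω.eq_of_forall fun u => by rw [← LinearMap.IsAlt.neg hω.isAlt, hv, neg_zero, map_zero]
  exact ⟨_, hb.toMatrix_eq hω.isAlt⟩

variable {c : Module.Basis (Fin n × Fin 2) K V}

theorem charpoly_map_eval_zero
    (hc : LinearMap.BilinForm.toMatrix c ω = stdMatrix K n) :
    (charpoly ω hω M).map (Polynomial.evalRingHom 0) =
    psi ω (M * adj ω hω M) := by
  rw [charpoly, psi_shiftProd hω M _ _ hc, psi_eq_pfaffian hω.isAlt (isAlt_mul_adj hω M) c hc,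
    ← Polynomial.coe_mapRingHom, ← pfaffian_map]
  congr 1
  ext p q : 1
  simp only [linearPencil, Matrix.map_apply, Matrix.of_apply, Matrix.add_apply, Matrix.sub_apply,
    Matrix.smul_apply, Polynomial.coe_mapRingHom]
  rw [← stdMatrix_map (algebraMap K K[X])]
  simp

theorem charpoly_map_algebraMap
    (hc : LinearMap.BilinForm.toMatrix c ω = stdMatrix K n) :
    (charpoly ω hω M).map (algebraMap K[X] (RatFunc K)) =
      psi (LinearMap.BilinForm.baseChange (RatFunc K) ω)
        (shiftProd ω hω M (RatFunc K) RatFunc.X) := by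
  rw [charpoly, psi_shiftProd hω M _ _ hc, psi_shiftProd hω M _ _ hc, ← Polynomial.coe_mapRingHom,
    ← pfaffian_map]
  congr 1
  ext p q : 1
  simp only [linearPencil, Matrix.map_apply, Matrix.of_apply, Matrix.add_apply, Matrix.sub_apply,
    Matrix.smul_apply, Polynomial.coe_mapRingHom]
  rw [← stdMatrix_map (algebraMap K[X] (RatFunc K))]
  simp

/-- The squares of both sides are the characteristic polynomials of `(M^{*ω} - s)(M - s)` and
`(M - s)(M^{*ω} - s)`, which agree; the sign is determined by the leading coefficients. -/
theorem charpoly_adj (hc : LinearMap.BilinForm.toMatrix c ω = stdMatrix K n) :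
    charpoly ω hω (adj ω hω M) = charpoly ω hω M := by
  have hAlt := isAlt_baseChange K[X] hc
  have hStd := toMatrix_baseChange_eq_stdMatrix K[X] hc
  have hlead : ∀ N, (charpoly ω hω N).coeff n = (-1) ^ n := fun N =>
    coeff_psi hAlt (isAlt_compRight_shiftProd hω N _ _ hc) _ hStd
  have := Module.Finite.of_basis c
  have hsq : ∀ N, charpoly ω hω N ^ 2 =
      LinearMap.charpoly (shiftProd ω hω N K[X] Polynomial.X) := fun N =>
    psi_sq hAlt (isAlt_compRight_shiftProd hω N _ _ hc) _ hStd
  have hcomm : ∀ A B : Module.End K[X] (K[X] ⊗[K] V),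
      LinearMap.charpoly (A * B) = LinearMap.charpoly (B * A) := fun A B => by
    rw [← LinearMap.charpoly_toMatrix _ (c.baseChange K[X]),
      ← LinearMap.charpoly_toMatrix _ (c.baseChange K[X]), LinearMap.toMatrix_mul,
      LinearMap.toMatrix_mul, Matrix.charpoly_mul_comm]
  have h : charpoly ω hω (adj ω hω M) ^ 2 = charpoly ω hω M ^ 2 := by
    rw [hsq, hsq, shiftProd, shiftProd, adj_adj, hcomm]
  rcases sq_eq_sq_iff_eq_or_eq_neg.1 h with h | h
  · exact h
  · -- If both signs are possible, the characteristic is two.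
    have h2 : (2 : K[X]) = 0 := by
      have h1 := congrArg (fun p => p.coeff n) h
      simp only [Polynomial.coeff_neg, hlead] at h1
      have hs : ((-1 : K[X]) ^ n) * (-1) ^ n = 1 := by rw [← mul_pow]; simp
      linear_combination (-1) ^ n * h1 - 2 * hs
    have h3 : (2 : K[X][X]) = 0 := by
      rw [← Polynomial.C_ofNat, h2, Polynomial.C_0]
    rw [h]
    linear_combination -(charpoly ω hω M) * h3

/-- At `t = 0`, the form `ω(v, (M^{*ω} - s)(M - s) w)` is the pullback of `ω` by `M - s`. -/
theorem coeff_zero_charpoly [FiniteDimensional K V]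
    (hc : LinearMap.BilinForm.toMatrix c ω = stdMatrix K n) :
    (charpoly ω hω M).coeff 0 = LinearMap.charpoly M := by
  have hStd := toMatrix_baseChange_eq_stdMatrix K[X] hc
  rw [← charpoly_adj hω M hc, charpoly, psi_eq_pfaffian (isAlt_baseChange K[X] hc)
    (isAlt_compRight_shiftProd hω _ _ _ hc) _ hStd, coeff_zero_pfaffian_linearPencil]
  let D : Module.End K[X] (K[X] ⊗[K] V) :=
    LinearMap.baseChange K[X] M - (Polynomial.X : K[X]) • 1
  have hD : LinearMap.BilinForm.toMatrix (c.baseChange K[X])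
      ((LinearMap.BilinForm.baseChange K[X] ω).compRight
        (shiftProd ω hω (adj ω hω M) K[X] Polynomial.X)) =
      (LinearMap.toMatrix (c.baseChange K[X]) (c.baseChange K[X]) D).transpose *
        stdMatrix K[X] n * LinearMap.toMatrix (c.baseChange K[X]) (c.baseChange K[X]) D := by
    rw [← hStd, ← LinearMap.BilinForm.toMatrix_comp (c.baseChange K[X])]
    ext p q : 1
    simp [LinearMap.BilinForm.toMatrix_apply, shiftProd, D, adj_adj, apply_adj_right]
  have hdet : LinearMap.toMatrix (c.baseChange K[X]) (c.baseChange K[X]) D =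
      -(LinearMap.toMatrix c c M).charmatrix := by
    have h₁ : ∀ A B : Module.End K[X] (K[X] ⊗[K] V),
        LinearMap.toMatrix (c.baseChange K[X]) (c.baseChange K[X]) (A - B) =
          LinearMap.toMatrix (c.baseChange K[X]) (c.baseChange K[X]) A -
            LinearMap.toMatrix (c.baseChange K[X]) (c.baseChange K[X]) B :=
      fun A B => map_sub _ A B
    have h₂ : LinearMap.toMatrix (c.baseChange K[X]) (c.baseChange K[X])
        ((Polynomial.X : K[X]) • 1) = (Polynomial.X : K[X]) • 1 := by
      rw [map_smul, LinearMap.toMatrix_one]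
    have h₃ : LinearMap.toMatrix (c.baseChange K[X]) (c.baseChange K[X])
        (LinearMap.baseChange K[X] M) = (LinearMap.toMatrix c c M).map (algebraMap K K[X]) := by
      ext p q : 1
      simp [LinearMap.toMatrix_apply, Algebra.smul_def]
    rw [h₁, h₂, h₃, Matrix.charmatrix, Matrix.scalar_apply,
      ← Matrix.smul_one_eq_diagonal, neg_sub, RingHom.mapMatrix_apply, Polynomial.algebraMap_eq]
  rw [hD, pfaffian_congr stdMatrix_isAlternating, pfaffian_stdMatrix, hdet, Matrix.det_neg,
    ← LinearMap.charpoly_toMatrix M c, Matrix.charpoly]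
  simp

/-- If `P` is symplectic, the matrices of `P⁻¹ M P` in a symplectic basis are those of `M` in its
image under `P`. -/
theorem charpoly_conj (hc : LinearMap.BilinForm.toMatrix c ω = stdMatrix K n)
    {P : V ≃ₗ[K] V} (hP : P ∈ Sp ω) :
    charpoly ω hω (P.symm.toLinearMap ∘ₗ M ∘ₗ P.toLinearMap) = charpoly ω hω M := by
  have hcP : LinearMap.BilinForm.toMatrix (c.map P) ω = stdMatrix K n := by
    rw [← hc]
    ext p q
    simp only [LinearMap.BilinForm.toMatrix_apply, Module.Basis.map_apply]
    exact hP _ _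
  have h : ∀ v w, ω v (P.symm w) = ω (P v) w := fun v w => by
    rw [← hP v (P.symm w), P.apply_symm_apply]
  have h₁ : LinearMap.BilinForm.toMatrix c (ω.compRight
      ((P.symm.toLinearMap ∘ₗ M ∘ₗ P.toLinearMap) *
        adj ω hω (P.symm.toLinearMap ∘ₗ M ∘ₗ P.toLinearMap))) =
      LinearMap.BilinForm.toMatrix (c.map P) (ω.compRight (M * adj ω hω M)) := by
    ext p q
    simp [LinearMap.BilinForm.toMatrix_apply, adj_conj hω M hP, h]
  have h₂ : LinearMap.BilinForm.toMatrix c (ω.compRight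
      ((P.symm.toLinearMap ∘ₗ M ∘ₗ P.toLinearMap) +
        adj ω hω (P.symm.toLinearMap ∘ₗ M ∘ₗ P.toLinearMap))) =
      LinearMap.BilinForm.toMatrix (c.map P) (ω.compRight (M + adj ω hω M)) := by
    ext p q
    simp [LinearMap.BilinForm.toMatrix_apply, adj_conj hω M hP, h]
  rw [charpoly, charpoly, psi_shiftProd hω _ _ _ hc, psi_shiftProd hω M _ _ hcP, h₁, h₂]

/-- The substitution `t = (σ - s)(τ - s)` turns the pencil defining `Φ_M` into a pencil which is
linear in `s`, since `(M - s)(M^{*ω} - s) - (σ - s)(τ - s)` has no term in `s ^ 2`. -/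
theorem charpoly_eval_eq_pfaffian
    (hc : LinearMap.BilinForm.toMatrix c ω = stdMatrix K n)
    {R : Type*} [CommRing R] [Algebra K R] (σ τ : R) :
    ((charpoly ω hω M).map (Polynomial.mapRingHom (algebraMap K R))).eval
        ((Polynomial.C σ - Polynomial.X) * (Polynomial.C τ - Polynomial.X)) =
      pfaffian (linearPencil
        ((LinearMap.BilinForm.toMatrix c (ω.compRight (M * adj ω hω M))).map (algebraMap K R) -
          (σ * τ) • stdMatrix R n)
        ((LinearMap.BilinForm.toMatrix c (ω.compRight (M + adj ω hω M))).map (algebraMap K R) -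
          (σ + τ) • stdMatrix R n)) := by
  rw [Polynomial.eval_map, ← Polynomial.coe_eval₂RingHom, charpoly, psi_shiftProd hω M _ _ hc,
    ← pfaffian_map]
  congr 1
  ext p q : 1
  simp only [linearPencil, Matrix.map_apply, Matrix.of_apply, Matrix.add_apply, Matrix.sub_apply,
    Matrix.smul_apply]
  rw [← stdMatrix_map (algebraMap K K[X]), ← stdMatrix_map (algebraMap K R)]
  simp [Polynomial.eval₂_pow]
  ring

theorem aeval_psi (hω : IsSymplectic ω)
    (hc : LinearMap.BilinForm.toMatrix c ω = stdMatrix K n)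
    {A : Module.End K V} (hA : (ω.compRight A).IsAlt) {R : Type*} [CommRing R]
    [Algebra K R] (r : R) :
    Polynomial.aeval r (psi ω A) =
      pfaffian ((LinearMap.BilinForm.toMatrix c (ω.compRight A)).map (algebraMap K R) -
        r • stdMatrix R n) := by
  rw [psi_eq_pfaffian hω.isAlt hA c hc, ← AlgHom.coe_toRingHom, ← pfaffian_map]
  congr 1
  ext p q
  rw [← stdMatrix_map (algebraMap K R)]
  simp [linearPencil]
  ring

theorem charpoly_eval_coeffs (hc : LinearMap.BilinForm.toMatrix c ω = stdMatrix K n)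
    {R : Type*} [CommRing R] [Algebra K R] (σ τ : R) (p : R[X])
    (hp : p = ((charpoly ω hω M).map (Polynomial.mapRingHom (algebraMap K R))).eval
      ((Polynomial.C σ - Polynomial.X) * (Polynomial.C τ - Polynomial.X))) :
    p.natDegree ≤ n ∧ p.coeff 0 = Polynomial.aeval (σ * τ) (psi ω (M * adj ω hω M)) ∧
      p.coeff n = Polynomial.aeval (σ + τ) (psi ω (M + adj ω hω M)) * (-1) ^ n := by
  rw [charpoly_eval_eq_pfaffian hω M hc] at hp
  subst hp
  refine ⟨natDegree_pfaffian_linearPencil_le _ _, ?_, ?_⟩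
  · rw [coeff_zero_pfaffian_linearPencil, aeval_psi hω hc (isAlt_mul_adj hω M)]
  · rw [coeff_pfaffian_linearPencil, aeval_psi hω hc (isAlt_add_adj hω M), mul_comm]

theorem hasEigenvalue_of_psi_eval_eq_zero [FiniteDimensional K V] (hω : IsSymplectic ω)
    (hc : LinearMap.BilinForm.toMatrix c ω = stdMatrix K n)
    {A : Module.End K V}
    (hA : (ω.compRight A).IsAlt) {r : K} (h : Polynomial.aeval r (psi ω A) = 0) :
    A.HasEigenvalue r := by
  rw [Module.End.hasEigenvalue_iff_isRoot_charpoly, ← psi_sq hω.isAlt hA c hc,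
    Polynomial.IsRoot, Polynomial.eval_pow, ← Polynomial.coe_aeval_eq_eval, h]
  simp

theorem hasEigenvalues_of_charpoly_eval_eq_zero [FiniteDimensional K V]
    (hc : LinearMap.BilinForm.toMatrix c ω = stdMatrix K n) (l m : K)
    (h : (charpoly ω hω M).eval
      ((Polynomial.C l - Polynomial.X) * (Polynomial.C m - Polynomial.X)) = 0) :
    M.HasEigenvalue l ∧ M.HasEigenvalue m ∧ (M * adj ω hω M).HasEigenvalue (l * m) ∧
      (M + adj ω hω M).HasEigenvalue (l + m) := by
  -- `Φ_M(s, q) - Φ_M(s, 0)` is divisible by `q`, and `Φ_M(s, 0)` is the characteristic polynomial.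
  have hdvd : (Polynomial.C l - Polynomial.X) * (Polynomial.C m - Polynomial.X) ∣
      LinearMap.charpoly M := by
    have := Polynomial.sub_dvd_eval_sub
      ((Polynomial.C l - Polynomial.X) * (Polynomial.C m - Polynomial.X)) 0 (charpoly ω hω M)
    rwa [h, sub_zero, zero_sub, dvd_neg, ← Polynomial.coeff_zero_eq_eval_zero,
      coeff_zero_charpoly hω M hc] at this
  have hroot : ∀ r : K, r = l ∨ r = m → M.HasEigenvalue r := by
    intro r hr
    rw [Module.End.hasEigenvalue_iff_isRoot_charpoly]
    refine Polynomial.IsRoot.dvd ?_ hdvd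
    rcases hr with rfl | rfl <;> simp [Polynomial.IsRoot]
  obtain ⟨-, h₀, h₁⟩ := charpoly_eval_coeffs hω M hc l m 0 (by
    rw [← h, Algebra.algebraMap_self, Polynomial.mapRingHom_id, Polynomial.map_id])
  refine ⟨hroot l (.inl rfl), hroot m (.inr rfl), ?_, ?_⟩
  · exact hasEigenvalue_of_psi_eval_eq_zero hω hc (isAlt_mul_adj hω M) h₀.symm
  · refine hasEigenvalue_of_psi_eval_eq_zero hω hc (isAlt_add_adj hω M) ?_
    exact (mul_eq_zero.1 h₁.symm).resolve_right (isUnit_one.neg.pow n).ne_zero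

theorem trace_shiftProd [FiniteDimensional K V] (hn : Module.finrank K V = 2 * n) :
    LinearMap.trace K[X] (K[X] ⊗[K] V) (shiftProd ω hω M K[X] Polynomial.X) =
      Polynomial.C (LinearMap.trace K V (M * adj ω hω M)) -
        2 * Polynomial.C (LinearMap.trace K V M) * Polynomial.X +
        2 * (n : K[X]) * Polynomial.X ^ 2 := by
  have hsub : ∀ A B : Module.End K[X] (K[X] ⊗[K] V), LinearMap.trace K[X] _ (A - B) =
      LinearMap.trace K[X] _ A - LinearMap.trace K[X] _ B := fun A B => map_sub _ A B
  rw [shiftProd_eq, map_add, hsub, map_smul, map_smul,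
    LinearMap.trace_baseChange,
    LinearMap.trace_baseChange, LinearMap.trace_one, Module.finrank_baseChange, hn, map_add,
    trace_adj, Polynomial.algebraMap_eq]
  simp
  ring

end Charpoly

end Symplectic

theorem mainTheorem8 {K : Type u} {V : Type v} [Field K] [AddCommGroup V] [Module K V]
    [FiniteDimensional K V] (n : ℕ) (hn : Module.finrank K V = 2 * n)
    (ω : LinearMap.BilinForm K V) (hω : Symplectic.IsSymplectic ω) (M : Module.End K V) :
    -- `Φ_M(s, t)` is `ψ` of the endomorphism `(M - sE)(M^{*ω} - sE)` of the `K(s)`-space `V ⊗ K(s)`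
    (Symplectic.charpoly ω hω M).map (algebraMap K[X] (RatFunc K)) =
      Symplectic.psi (LinearMap.BilinForm.baseChange (RatFunc K) ω)
        (Symplectic.shiftProd ω hω M (RatFunc K) RatFunc.X) ∧
    -- (1) `Φ_M(0, t) = ψ_{M M^{*ω}}(t)`
    (Symplectic.charpoly ω hω M).map (Polynomial.evalRingHom 0) =
      Symplectic.psi ω (M * Symplectic.adj ω hω M) ∧
    -- (2) `Φ_M(s, 0) = φ_M(s)`
    (Symplectic.charpoly ω hω M).eval 0 = LinearMap.charpoly M ∧
    -- (3) `Φ_M(s, (σ - s)(τ - s)) = ψ_{M M^{*ω}}(σ τ) + ⋯ + ψ_{M + M^{*ω}}(σ + τ) (-s)ⁿ`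
    (∀ (R : Type w) [CommRing R] [Algebra K R] (σ τ : R) (p : R[X]),
      p = ((Symplectic.charpoly ω hω M).map (Polynomial.mapRingHom (algebraMap K R))).eval
          ((Polynomial.C σ - Polynomial.X) * (Polynomial.C τ - Polynomial.X)) →
      p.natDegree ≤ n ∧
      p.coeff 0 = Polynomial.aeval (σ * τ) (Symplectic.psi ω (M * Symplectic.adj ω hω M)) ∧
      p.coeff n =
        Polynomial.aeval (σ + τ) (Symplectic.psi ω (M + Symplectic.adj ω hω M)) * (-1) ^ n) ∧
    -- (4) `Φ_M(s, (l - s)(m - s)) = 0` gives eigenvalues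
    (∀ l m : K,
      (Symplectic.charpoly ω hω M).eval
          ((Polynomial.C l - Polynomial.X) * (Polynomial.C m - Polynomial.X)) = 0 →
      Module.End.HasEigenvalue M l ∧ Module.End.HasEigenvalue M m ∧
      Module.End.HasEigenvalue (M * Symplectic.adj ω hω M) (l * m) ∧
      Module.End.HasEigenvalue (M + Symplectic.adj ω hω M) (l + m)) ∧
    -- (5) invariance under symplectic similarity and under the symplectic adjoint
    (∀ P ∈ Symplectic.Sp ω,
      Symplectic.charpoly ω hω (P.symm.toLinearMap ∘ₗ M ∘ₗ P.toLinearMap) =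
        Symplectic.charpoly ω hω M) ∧
    Symplectic.charpoly ω hω (Symplectic.adj ω hω M) = Symplectic.charpoly ω hω M ∧
    -- (6) `Φ_M(s, t)²` is the characteristic polynomial of `(M - sE)(M^{*ω} - sE)`
    ((Symplectic.charpoly ω hω M).map (algebraMap K[X] (RatFunc K))) ^ 2 =
      LinearMap.charpoly (Symplectic.shiftProd ω hω M (RatFunc K) RatFunc.X) ∧
    -- (7) degree and coefficients in `t`
    (Symplectic.charpoly ω hω M).natDegree = n ∧
    (Symplectic.charpoly ω hω M).coeff 0 = LinearMap.charpoly M ∧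
    (1 ≤ n →
      2 * (Symplectic.charpoly ω hω M).coeff (n - 1) =
        (-1) ^ (n - 1) *
          (Polynomial.C (LinearMap.trace K V (M * Symplectic.adj ω hω M)) -
            2 * Polynomial.C (LinearMap.trace K V M) * Polynomial.X +
            2 * (n : K[X]) * Polynomial.X ^ 2)) ∧
    (Symplectic.charpoly ω hω M).coeff n = (-1) ^ n ∧
    -- (8) Cayley-Hamilton: `Φ_M(s, (M - sE)(M^{*ω} - sE)) = O`
    Polynomial.aeval (Symplectic.shiftProd ω hω M (RatFunc K) RatFunc.X)
      ((Symplectic.charpoly ω hω M).map (algebraMap K[X] (RatFunc K))) = 0 := by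
  obtain ⟨c, hc⟩ := hω.exists_toMatrix_eq_stdMatrix hn
  have hX := Symplectic.isAlt_baseChange K[X] hc
  have hX' := Symplectic.isAlt_compRight_shiftProd hω M K[X] Polynomial.X hc
  have hXc := Symplectic.toMatrix_baseChange_eq_stdMatrix K[X] hc
  have hF := Symplectic.isAlt_baseChange (RatFunc K) hc
  have hF' := Symplectic.isAlt_compRight_shiftProd hω M (RatFunc K) RatFunc.X hc
  have hFc := Symplectic.toMatrix_baseChange_eq_stdMatrix (RatFunc K) hc
  refine ⟨Symplectic.charpoly_map_algebraMap hω M hc, Symplectic.charpoly_map_eval_zero hω M hc,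
    ?_, fun R _ _ σ τ p hp => Symplectic.charpoly_eval_coeffs hω M hc σ τ p hp,
    Symplectic.hasEigenvalues_of_charpoly_eval_eq_zero hω M hc,
    fun P hP => Symplectic.charpoly_conj hω M hc hP, Symplectic.charpoly_adj hω M hc, ?_,
    Symplectic.natDegree_psi hX hX' _ hXc, Symplectic.coeff_zero_charpoly hω M hc, fun h => ?_,
    Symplectic.coeff_psi hX hX' _ hXc, ?_⟩
  · rw [← Polynomial.coeff_zero_eq_eval_zero, Symplectic.coeff_zero_charpoly hω M hc]
  · rw [Symplectic.charpoly_map_algebraMap hω M hc, Symplectic.psi_sq hF hF' _ hFc]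
  · rw [← Symplectic.trace_shiftProd hω M hn]
    exact Symplectic.two_mul_coeff_psi hX hX' _ hXc h
  · rw [Symplectic.charpoly_map_algebraMap hω M hc]
    exact Symplectic.aeval_self_psi hF hF' _ hFc
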